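/- Let $r\ge 0$, $k\ge 0$ and $m\ge 0$ be integers and let $\beta=(\beta_1,\ldots,\beta_m)$ be a sequence of nonnegative integers. Let $\mathcal{OP}_{r;\beta,k}$ be the set of sequences $\pi=B_1/\cdots/B_k$ of $k$ nonempty finite sets (the blocks) such that the multiset union of the blocks is $\{0^r,1^{\beta_1},\ldots,m^{\beta_m}\}$ and such that $0\notin B_k$ (if $k\ge 1$). For $\pi=B_1/\cdots/B_k\in\mathcal{OP}_{r;\beta,k}$ define three statistics. * $\mathrm{inv}(\pi)$ is the number of pairs of an entry $a$ of a block $B_i$ and the minimum $b=\min B_j$ of a block $B_j$ with $i<j$ and $a>b$ (entries of different blocks are counted separately). * Let $\sigma=\sigma_1\sigma_2\cdots$ be the word obtained by writing the blocks $B_1,\ldots,B_k$ from left to right, each in decreasing order, and let $\mathrm{ind}(\pi)=0^{|B_1|}1^{|B_2|}\cdots(k-1)^{|B_k|}$. Then $\mathrm{maj}(\pi)=\sum_{i:\,\sigma_i>\sigma_{i+1}}\mathrm{ind}(\pi)_{i+1}$. * Let $B_i^h$ be the $h$-th smallest element of $B_i$, for $1\le h\le |B_i|$. Then $\mathrm{dinv}(\pi)$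 is the number of triples $(h,i,j)$ with $i<j$ and $B_i^h>B_j^h$ (primary diagonal inversions) plus the number of triples $(h,i,j)$ with $i<j$ and $B_i^h<B_j^{h+1}$ (secondary diagonal inversions), where only triples for which both entries exist are counted. Then, as polynomials in $q$, $$\sum_{\pi\in\mathcal{OP}_{r;\beta,k}}q^{\mathrm{inv}(\pi)}=\sum_{\pi\in\mathcal{OP}_{r;\beta,k}}q^{\mathrm{maj}(\pi)}=\sum_{\pi\in\mathcal{OP}_{r;\beta,k}}q^{\mathrm{dinv}(\pi)}.$$ -/

import Mathlib

namespace ExtOMP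

/-- The multiset `{0^r} ∪ {1^(β₁), …, m^(β_m)}`; the index `i : Fin m` stands for the letter
`i + 1`. -/
def content (r : ℕ) {m : ℕ} (β : Fin m → ℕ) : Multiset ℕ :=
  Multiset.replicate r 0 + ∑ i : Fin m, Multiset.replicate (β i) ((i : ℕ) + 1)

/-- Extended ordered multiset partitions `B₁ / ⋯ / B_k` of content `β` with `r` zeros and with
`k` blocks. A block is a nonempty finite set (so no letter is repeated inside a block), the blocks
together use every letter with the prescribed multiplicity, and `0` is not in the last block. -/
def OP (r : ℕ) {m : ℕ} (β : Fin m → ℕ) (k : ℕ) : Set (List (Finset ℕ)) :=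
  {π | π.length = k ∧ (∀ B ∈ π, B.Nonempty) ∧ (π.map Finset.val).sum = content r β ∧
    ∀ B ∈ π.getLast?, 0 ∉ B}

theorem OP_finite (r : ℕ) {m : ℕ} (β : Fin m → ℕ) (k : ℕ) : (OP r β k).Finite := by
  refine Set.Finite.subset
    (s := {π : List (Finset ℕ) | π.length = k ∧
      ∀ B ∈ π, B ∈ ((content r β).toFinset.powerset : Set (Finset ℕ))}) ?_ ?_
  · have h := List.finite_length_eq ((content r β).toFinset.powerset) k
    refine (h.image (List.map Subtype.val)).subset ?_
    rintro π ⟨hl, hB⟩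
    refine ⟨π.attach.map (fun B => ⟨B.1, by exact_mod_cast hB B.1 B.2⟩), ?_, ?_⟩
    · simpa using hl
    · simp [List.map_map, Function.comp_def]
  · rintro π ⟨hl, -, hs, -⟩
    refine ⟨hl, fun B hB => ?_⟩
    simp only [Finset.mem_coe, Finset.mem_powerset]
    intro x hx
    rw [Multiset.mem_toFinset, ← hs]
    exact Multiset.mem_of_le (List.single_le_sum (by simp) _ (List.mem_map_of_mem hB)) hx

/-- The generating function `∑ q^(stat π)` over all `π` in `OP r β k`, a polynomial in `q`. -/
noncomputable def D (stat : List (Finset ℕ) → ℕ) (r : ℕ) {m : ℕ} (β : Fin m → ℕ) (k : ℕ) :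
    Polynomial ℤ :=
  ∑ π ∈ (OP_finite r β k).toFinset, Polynomial.X ^ stat π

/-- Pairs `(i, j)` of positions of blocks of `π` with `i < j`. -/
def blockPairs (π : List (Finset ℕ)) : Finset (Fin π.length × Fin π.length) :=
  Finset.univ.filter fun p => p.1 < p.2

/-- The number of pairs `a > b`, where `b` is the minimum of its block and `a` is an entry of a
block strictly to the left of the block of `b`. -/
def inv (π : List (Finset ℕ)) : ℕ :=
  ∑ p ∈ blockPairs π,
    ((π.get p.1 ×ˢ π.get p.2).filter fun ab => ab.1 > ab.2 ∧ ∀ c ∈ π.get p.2, ab.2 ≤ c).card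

/-- The word obtained by writing each block in decreasing order, from left to right. -/
def word (π : List (Finset ℕ)) : List ℕ :=
  π.flatMap fun B => B.sort (fun a b => a ≥ b)

/-- The index word `0^|B₁| 1^|B₂| ⋯ (k-1)^|B_k|`. -/
def ind (π : List (Finset ℕ)) : List ℕ :=
  π.zipIdx.flatMap fun Bi => List.replicate Bi.1.card Bi.2

/-- The sum of `ind_(i+1)` over the descents `σ_i > σ_(i+1)` of `σ = word π`. -/
def maj (π : List (Finset ℕ)) : ℕ :=
  ∑ i ∈ (Finset.range ((word π).length - 1)).filter
      (fun i => (word π).getD i 0 > (word π).getD (i + 1) 0),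
    (ind π).getD (i + 1) 0

/-- `entry B h` is the `(h+1)`-st smallest element of `B`; it is used only for `h < B.card`. -/
def entry (B : Finset ℕ) (h : ℕ) : ℕ := (B.sort (fun a b => a ≤ b)).getD h 0

/-- The number of heights `h` at which `B` (left) has a larger entry than `C` (right), both
entries being present. -/
def primaryDinv (B C : Finset ℕ) : ℕ :=
  ((Finset.range B.card).filter fun h => h < C.card ∧ entry B h > entry C h).card

/-- The number of heights `h` such that the entry of `B` (left) at height `h` is smaller than the
entry of `C` (right) at height `h + 1`, both entries being present. -/
def secondaryDinv (B C : Finset ℕ) : ℕ :=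
  ((Finset.range B.card).filter fun h => h + 1 < C.card ∧ entry B h < entry C (h + 1)).card

/-- The number of primary diagonal inversions plus the number of secondary ones. -/
def dinv (π : List (Finset ℕ)) : ℕ :=
  ∑ p ∈ blockPairs π,
    (primaryDinv (π.get p.1) (π.get p.2) + secondaryDinv (π.get p.1) (π.get p.2))

end ExtOMP

/-! For every `x`, spread the blocks of a partition over positions `p₁ < ⋯ < p_k` in `{0, …, x -
1}`, that is, consider `x`-tuples of possibly empty blocks, with any number of nonempty ones. The
weight `q^(stat + ∑ pᵢ)` has total `∑ k, D stat k * placements (1^k) x`. Since `placements (1^k) x`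
vanishes for `x < k` but not for `x = k`, these totals determine every `D stat k`
(`D_eq_of_sum_eq`). For each of the three statistics the total equals that of the weight `q^(∑ pᵢ
|Bᵢ|)`.

For `inv` and `dinv`, build the tuples letter by letter in increasing order. Inserting a new largest
letter at a set `T` of positions raises the exponent by the sum over `T` of ranks in a total order
of the positions, which depends on the tuple built so far; for `∑ pᵢ |Bᵢ|` it is the usual order.
Hence each letter contributes the same factor in all cases. The condition on `0` is preserved
because the orders agree beyond the last nonempty block (`IsInsertionStat.sum_eq`).

For `maj`, fix the word `σ`. Its partitions arise by cutting at every non-descent and at any chosen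
descents. Summed over these, both weights give the same power of `q` times the Gaussian binomial of
`x + des σ` over the length of `σ` (`sum_cuttings_placements_card`, `sum_cuttings_maj`). -/

namespace ExtOMP

open Finset Polynomial

/-! ### Placements of weights, and tuples with empty blocks -/

/-- The polynomial `∑ q^(∑ pᵢ wᵢ)` over all positions `p₁ < p₂ < ⋯ < x` of the weights `w`. -/
noncomputable def placements : List ℕ → ℕ → ℤ[X]
  | [], _ => 1
  | _ :: _, 0 => 0
  | a :: w, x + 1 => X ^ (a + w.sum) * placements (a :: w) x + X ^ w.sum * placements w x

@[simp] theorem placements_nil (x : ℕ) : placements [] x = 1 := by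
  cases x <;> rw [placements]

@[simp] theorem placements_cons_zero (a : ℕ) (w : List ℕ) : placements (a :: w) 0 = 0 := by
  rw [placements]

theorem placements_cons_succ (a : ℕ) (w : List ℕ) (x : ℕ) :
    placements (a :: w) (x + 1) =
      X ^ (a + w.sum) * placements (a :: w) x + X ^ w.sum * placements w x := by
  rw [placements]

theorem placements_eq_zero (w : List ℕ) (x : ℕ) (h : x < w.length) : placements w x = 0 := by
  induction x generalizing w with
  | zero => cases w with
    | nil => simp at h
    | cons a w => simp
  | succ x ih => cases w with
    | nil => simp at h
    | cons a w =>
      simp only [List.length_cons] at h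
      rw [placements_cons_succ, ih _ (by simp; omega), ih _ (by omega)]
      simp

/-- With `placements_eq_zero`, this makes the system relating the `D stat r β k` to the totals over
tuples triangular. -/
theorem placements_length_ne_zero (w : List ℕ) : placements w w.length ≠ 0 := by
  induction w with
  | nil => simp
  | cons a w ih =>
    rw [List.length_cons, placements_cons_succ, placements_eq_zero _ _ (by simp)]
    simp [ih]

/-- The list of the nonempty blocks of a tuple of blocks. -/
def nonemptyBlocks {x : ℕ} (c : Fin x → Finset ℕ) : List (Finset ℕ) :=
  (List.ofFn c).filter fun B => B.Nonempty

theorem nonemptyBlocks_cons {x : ℕ} (B : Finset ℕ) (c : Fin x → Finset ℕ) :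
    nonemptyBlocks (Fin.cons B c : Fin (x + 1) → Finset ℕ) =
      if B.Nonempty then B :: nonemptyBlocks c else nonemptyBlocks c := by
  simp only [nonemptyBlocks, List.ofFn_succ, Fin.cons_zero, Fin.cons_succ, List.filter_cons,
    decide_eq_true_eq]

theorem nonempty_of_mem_nonemptyBlocks {x : ℕ} (c : Fin x → Finset ℕ) (B : Finset ℕ)
    (h : B ∈ nonemptyBlocks c) : B.Nonempty := by
  simpa using (List.mem_filter.1 h).2

theorem sum_piFinset_succ {R α : Type*} [AddCommMonoid R] (x : ℕ) (P : Finset α)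
    (f : (Fin (x + 1) → α) → R) :
    ∑ c ∈ Fintype.piFinset (fun _ : Fin (x + 1) => P), f c =
      ∑ B ∈ P, ∑ c ∈ Fintype.piFinset (fun _ : Fin x => P), f (Fin.cons B c) := by
  rw [← Finset.sum_product']
  refine Finset.sum_nbij' (fun c => (c 0, Fin.tail c)) (fun p => Fin.cons p.1 p.2) ?_ ?_ ?_ ?_ ?_
  · intro c hc
    simp only [Fintype.mem_piFinset, Finset.mem_product] at hc ⊢
    exact ⟨hc 0, fun i => hc i.succ⟩
  · intro p hp
    simp only [Fintype.mem_piFinset, Finset.mem_product] at hp ⊢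
    exact Fin.cases hp.1 hp.2
  · intro c _
    simp
  · intro p _
    simp
  · intro c _
    simp

/-- Summing over the ways to interleave the blocks of `π` with empty blocks. -/
theorem sum_nonemptyBlocks_eq (φ : Finset ℕ → ℕ) (hφ : φ ∅ = 0) (P : Finset (Finset ℕ))
    (hP : ∅ ∈ P) (x : ℕ) (π : List (Finset ℕ)) (hπ : ∀ B ∈ π, B ∈ P) (hne : ∀ B ∈ π, B.Nonempty) :
    ∑ c ∈ Fintype.piFinset (fun _ : Fin x => P) with nonemptyBlocks c = π,
        (X : ℤ[X]) ^ (∑ s : Fin x, (s : ℕ) * φ (c s)) =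
      placements (π.map φ) x := by
  have hsum : ∀ {x : ℕ} (c : Fin x → Finset ℕ),
      ∑ s, φ (c s) = ((nonemptyBlocks c).map φ).sum := by
    intro x c
    induction x with
    | zero => simp [nonemptyBlocks]
    | succ x ih =>
      rw [← Fin.cons_self_tail c, nonemptyBlocks_cons, Fin.sum_univ_succ]
      simp only [Fin.cons_zero, Fin.cons_succ]
      rw [ih]
      split_ifs with h
      · simp
      · rw [Finset.not_nonempty_iff_eq_empty.1 h, hφ, zero_add]
  induction x generalizing π with
  | zero =>
    cases π with
    | nil => simp [nonemptyBlocks, Finset.filter_true_of_mem]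
    | cons B π => simp [nonemptyBlocks]
  | succ x ih =>
    have key : ∀ (B : Finset ℕ) (c : Fin x → Finset ℕ),
        ∑ s : Fin (x + 1), (s : ℕ) * φ ((Fin.cons B c : Fin (x + 1) → Finset ℕ) s) =
          ((nonemptyBlocks c).map φ).sum + ∑ s : Fin x, (s : ℕ) * φ (c s) := by
      intro B c
      rw [Fin.sum_univ_succ, ← hsum, ← Finset.sum_add_distrib]
      simp only [Fin.cons_zero, Fin.cons_succ, Fin.val_succ, Fin.val_zero, zero_mul, zero_add]
      exact Finset.sum_congr rfl fun s _ => by ring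
    rw [Finset.sum_filter, sum_piFinset_succ]
    simp only [key, nonemptyBlocks_cons]
    -- An empty first block gives the first term of the recursion of `placements`; a nonempty one
    -- must be the head of `π`, sits at position 0, and gives the second.
    rw [← Finset.add_sum_erase _ _ hP]
    simp only [Finset.not_nonempty_empty, if_false]
    have h1 : ∑ c ∈ Fintype.piFinset (fun _ : Fin x => P),
        (if nonemptyBlocks c = π then
          (X : ℤ[X]) ^ (((nonemptyBlocks c).map φ).sum + ∑ s : Fin x, (s : ℕ) * φ (c s)) else 0) =
        X ^ (π.map φ).sum * placements (π.map φ) x := by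
      rw [← ih π hπ hne, Finset.mul_sum, ← Finset.sum_filter]
      refine Finset.sum_congr rfl fun c hc => ?_
      rw [(Finset.mem_filter.1 hc).2, pow_add]
    rw [h1]
    cases π with
    | nil =>
      rw [Finset.sum_eq_zero]
      · simp
      · intro B hB
        have : B.Nonempty := Finset.nonempty_iff_ne_empty.2 (Finset.mem_erase.1 hB).1
        simp [this]
    | cons A π =>
      have hA := hne A (by simp)
      rw [Finset.sum_eq_single A]
      · simp only [hA, if_true, List.cons.injEq, true_and]
        rw [List.map_cons, placements_cons_succ, List.sum_cons,
          ← ih π (fun B hB => hπ B (by simp [hB])) (fun B hB => hne B (by simp [hB])),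
          ← Finset.sum_filter, Finset.mul_sum]
        congr 1
        refine Finset.sum_congr rfl fun c hc => ?_
        rw [(Finset.mem_filter.1 hc).2, pow_add]
      · intro B hB hBA
        have : B.Nonempty := Finset.nonempty_iff_ne_empty.2 (Finset.mem_erase.1 hB).1
        simp [this, hBA]
      · intro h
        exact absurd (Finset.mem_erase.2 ⟨hA.ne_empty, hπ A (by simp)⟩) h

/-! ### Inversions and diagonal inversions under insertion of a largest letter -/

/-- The sum of `f B C` over the pairs of a block `B` and a block `C` to its right. -/
def pairSum (f : Finset ℕ → Finset ℕ → ℕ) : List (Finset ℕ) → ℕ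
  | [] => 0
  | B :: π => (π.map (f B)).sum + pairSum f π

theorem pairSum_ofFn (f : Finset ℕ → Finset ℕ → ℕ) {x : ℕ} (c : Fin x → Finset ℕ) :
    pairSum f (List.ofFn c) = ∑ i, ∑ j, if i < j then f (c i) (c j) else 0 := by
  induction x with
  | zero => simp [pairSum]
  | succ x ih =>
    rw [List.ofFn_succ, pairSum, ih, Fin.sum_univ_succ]
    congr 1
    · rw [Fin.sum_univ_succ]
      simp [List.map_ofFn, List.sum_ofFn]
    · refine Finset.sum_congr rfl fun i _ => ?_
      rw [Fin.sum_univ_succ]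
      simp

theorem sum_blockPairs (f : Finset ℕ → Finset ℕ → ℕ) (π : List (Finset ℕ)) :
    ∑ p ∈ blockPairs π, f (π.get p.1) (π.get p.2) = pairSum f π := by
  conv_rhs => rw [← List.ofFn_get π]
  rw [pairSum_ofFn, blockPairs, Finset.sum_filter, ← Finset.univ_product_univ,
    Finset.sum_product]

theorem pairSum_nonemptyBlocks (f : Finset ℕ → Finset ℕ → ℕ) (hl : ∀ B, f ∅ B = 0)
    (hr : ∀ B, f B ∅ = 0) {x : ℕ} (c : Fin x → Finset ℕ) :
    pairSum f (nonemptyBlocks c) = ∑ i, ∑ j, if i < j then f (c i) (c j) else 0 := by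
  rw [← pairSum_ofFn, nonemptyBlocks]
  generalize List.ofFn c = π
  have hsum : ∀ B, ∀ π : List (Finset ℕ),
      ((π.filter fun B => B.Nonempty).map (f B)).sum = (π.map (f B)).sum := by
    intro B π
    induction π with
    | nil => simp
    | cons C π ih =>
      rcases C.eq_empty_or_nonempty with rfl | h
      · simp [ih, hr]
      · simp [ih, h]
  induction π with
  | nil => simp
  | cons C π ih =>
    rcases C.eq_empty_or_nonempty with rfl | h
    · simp [ih, funext hl, pairSum]
    · simp [ih, h, pairSum, hsum]

/-- The number of inversions between a left block `B` and the minimum of a right block `C`. -/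
def pairInv (B C : Finset ℕ) : ℕ :=
  ((B ×ˢ C).filter fun ab => ab.1 > ab.2 ∧ ∀ c ∈ C, ab.2 ≤ c).card

/-- The number of diagonal inversions between a left block `B` and a right block `C`. -/
def pairDinv (B C : Finset ℕ) : ℕ := primaryDinv B C + secondaryDinv B C

theorem inv_eq_pairSum (π : List (Finset ℕ)) : inv π = pairSum pairInv π :=
  sum_blockPairs pairInv π

theorem dinv_eq_pairSum (π : List (Finset ℕ)) : dinv π = pairSum pairDinv π :=
  sum_blockPairs pairDinv π

theorem pairInv_empty_left (C : Finset ℕ) : pairInv ∅ C = 0 := by simp [pairInv]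

theorem pairInv_empty_right (B : Finset ℕ) : pairInv B ∅ = 0 := by simp [pairInv]

theorem pairDinv_empty_left (C : Finset ℕ) : pairDinv ∅ C = 0 := by
  simp [pairDinv, primaryDinv, secondaryDinv]

theorem pairDinv_empty_right (B : Finset ℕ) : pairDinv B ∅ = 0 := by
  simp [pairDinv, primaryDinv, secondaryDinv]

theorem pairInv_eq_card (B C : Finset ℕ) (b : ℕ) (hb : b ∈ C) (hmin : ∀ c ∈ C, b ≤ c) :
    pairInv B C = #{a ∈ B | b < a} := by
  have : (B ×ˢ C).filter (fun ab => ab.1 > ab.2 ∧ ∀ c ∈ C, ab.2 ≤ c) =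
      {a ∈ B | b < a} ×ˢ {b} := by
    ext ⟨u, v⟩
    simp only [mem_filter, mem_product, mem_singleton]
    constructor
    · rintro ⟨⟨hu, hv⟩, huv, h⟩
      obtain rfl : v = b := le_antisymm (h b hb) (hmin v hv)
      exact ⟨⟨hu, huv⟩, rfl⟩
    · rintro ⟨⟨hu, huv⟩, rfl⟩
      exact ⟨⟨hu, hb⟩, huv, hmin⟩
  rw [pairInv, this, card_product, card_singleton, mul_one]

/-- A largest letter does not change the minimum of a nonempty `C`, so only `N` in the left block
makes a new inversion. If `C` is empty, its new minimum can only be `N`, which nothing exceeds. -/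
theorem pairInv_insert (N : ℕ) (B C : Finset ℕ) (hB : ∀ a ∈ B, a < N) (hC : ∀ a ∈ C, a < N)
    (p q : Prop) [Decidable p] [Decidable q] :
    pairInv (if p then insert N B else B) (if q then insert N C else C) =
      pairInv B C + if p ∧ C.Nonempty then 1 else 0 := by
  rcases C.eq_empty_or_nonempty with rfl | hne
  · have h : ∀ B' : Finset ℕ, (∀ a ∈ B', a ≤ N) → pairInv B' {N} = 0 := by
      intro B' hB'
      rw [pairInv_eq_card _ _ N (by simp) (by simp), card_eq_zero, filter_eq_empty_iff]
      exact fun a ha => not_lt.2 (hB' a ha)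
    simp only [pairInv_empty_right, Finset.not_nonempty_empty, and_false, if_false]
    split_ifs
    · exact h _ fun a ha => by
        rcases mem_insert.1 ha with rfl | ha
        exacts [le_rfl, (hB a ha).le]
    · exact pairInv_empty_right _
    · exact h _ fun a ha => (hB a ha).le
    · exact pairInv_empty_right _
  · have hm := C.min'_mem hne
    have hmin : ∀ c ∈ C, C.min' hne ≤ c := fun c hc => C.min'_le c hc
    have hCq : ∀ B', pairInv B' (if q then insert N C else C) = pairInv B' C := by
      intro B'
      split_ifs
      · rw [pairInv_eq_card _ _ _ hm hmin, pairInv_eq_card _ _ _ (mem_insert_of_mem hm)]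
        intro c hc
        rcases mem_insert.1 hc with rfl | hc
        exacts [(hC _ hm).le, hmin c hc]
      · rfl
    rw [hCq]
    by_cases hp : p
    · simp only [hp, hne, if_true, and_self]
      rw [pairInv_eq_card _ _ _ hm hmin, pairInv_eq_card _ _ _ hm hmin, filter_insert,
        if_pos (hC _ hm), card_insert_of_notMem]
      exact fun h => lt_irrefl _ (hB _ (mem_filter.1 h).1)
    · simp [hp]

theorem sort_insert_of_lt (N : ℕ) (B : Finset ℕ) (hB : ∀ a ∈ B, a < N) :
    (insert N B).sort (fun a b => a ≤ b) = B.sort (fun a b => a ≤ b) ++ [N] := by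
  have hN : N ∉ B := fun h => lt_irrefl _ (hB N h)
  refine List.Perm.eq_of_pairwise' (r := fun a b : ℕ => a ≤ b) (Finset.pairwise_sort _ _) ?_ ?_
  · rw [List.pairwise_append]
    refine ⟨Finset.pairwise_sort _ _, by simp, fun a ha b hb => ?_⟩
    rw [List.mem_singleton.1 hb]
    exact (hB a ((Finset.mem_sort _).1 ha)).le
  · rw [← Multiset.coe_eq_coe, Finset.sort_eq, ← Multiset.coe_add, Finset.sort_eq,
      Finset.insert_val_of_notMem hN, add_comm, Multiset.coe_singleton, Multiset.singleton_add]

theorem entry_mem (B : Finset ℕ) (h : ℕ) (hh : h < #B) : entry B h ∈ B := by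
  rw [← Finset.length_sort (fun a b => a ≤ b)] at hh
  rw [entry, List.getD_eq_getElem _ _ hh]
  exact (Finset.mem_sort _).1 (List.getElem_mem hh)

theorem entry_insert_of_lt (N : ℕ) (B : Finset ℕ) (hB : ∀ a ∈ B, a < N) (h : ℕ) (hh : h < #B) :
    entry (insert N B) h = entry B h := by
  rw [entry, sort_insert_of_lt N B hB, List.getD_append _ _ _ _ (by simpa using hh), entry]

theorem entry_insert_card (N : ℕ) (B : Finset ℕ) (hB : ∀ a ∈ B, a < N) :
    entry (insert N B) #B = N := by
  rw [entry, sort_insert_of_lt N B hB, List.getD_append_right _ _ _ _ (by simp)]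
  simp

theorem card_filter_range_succ (p : ℕ → Prop) [DecidablePred p] (n : ℕ) :
    #{h ∈ range (n + 1) | p h} = #{h ∈ range n | p h} + if p n then 1 else 0 := by
  rw [range_add_one, filter_insert]
  split_ifs
  · rw [card_insert_of_notMem (by simp)]
  · rfl

theorem primaryDinv_insert_left (N : ℕ) (B C : Finset ℕ) (hB : ∀ a ∈ B, a < N)
    (hC : ∀ a ∈ C, a < N) :
    primaryDinv (insert N B) C = primaryDinv B C + if #B < #C then 1 else 0 := by
  rw [primaryDinv, card_insert_of_notMem fun h => lt_irrefl _ (hB _ h), card_filter_range_succ,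
    entry_insert_card N B hB]
  congr 1
  · refine congrArg card (filter_congr fun h hh => ?_)
    rw [entry_insert_of_lt N B hB h (mem_range.1 hh)]
  · refine if_congr ?_ rfl rfl
    exact and_iff_left_of_imp fun h => hC _ (entry_mem C _ h)

theorem primaryDinv_insert_right (N : ℕ) (B C : Finset ℕ) (hB : ∀ a ∈ B, a ≤ N)
    (hC : ∀ a ∈ C, a < N) : primaryDinv B (insert N C) = primaryDinv B C := by
  refine congrArg card (filter_congr fun h hh => ?_)
  rw [card_insert_of_notMem fun h => lt_irrefl _ (hC _ h)]
  rcases lt_trichotomy h #C with hl | rfl | hl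
  · rw [entry_insert_of_lt N C hC h hl]
    simp [hl, hl.trans (Nat.lt_succ_self _)]
  · rw [entry_insert_card N C hC]
    have := hB _ (entry_mem B _ (mem_range.1 hh))
    simp [this]
  · constructor <;> intro hlt <;> omega

theorem secondaryDinv_insert_left (N : ℕ) (B C : Finset ℕ) (hB : ∀ a ∈ B, a < N)
    (hC : ∀ a ∈ C, a < N) : secondaryDinv (insert N B) C = secondaryDinv B C := by
  rw [secondaryDinv, card_insert_of_notMem fun h => lt_irrefl _ (hB _ h), card_filter_range_succ,
    entry_insert_card N B hB, if_neg, add_zero]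
  · refine congrArg card (filter_congr fun h hh => ?_)
    rw [entry_insert_of_lt N B hB h (mem_range.1 hh)]
  · exact fun h => lt_asymm h.2 (hC _ (entry_mem C _ h.1))

theorem secondaryDinv_insert_right (N : ℕ) (B C : Finset ℕ) (hC : ∀ a ∈ C, a < N) :
    secondaryDinv B (insert N C) = secondaryDinv B C +
      if 0 < #C ∧ #C ≤ #B ∧ entry B (#C - 1) < N then 1 else 0 := by
  have hsplit : ∀ h, (h + 1 < #C + 1 ∧ entry B h < entry (insert N C) (h + 1)) ↔
      (h + 1 < #C ∧ entry B h < entry C (h + 1)) ∨ (h + 1 = #C ∧ entry B h < N) := by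
    intro h
    rcases lt_trichotomy (h + 1) #C with hl | hl | hl
    · rw [entry_insert_of_lt N C hC _ hl]
      constructor
      · exact fun hh => Or.inl ⟨hl, hh.2⟩
      · rintro (hh | hh)
        exacts [⟨by omega, hh.2⟩, absurd hh.1 hl.ne]
    · rw [hl, entry_insert_card N C hC]
      simp
    · constructor <;> intro hlt <;> omega
  rw [secondaryDinv, card_insert_of_notMem fun h => lt_irrefl _ (hC _ h),
    filter_congr fun h _ => hsplit h, filter_or, card_union_of_disjoint, ← secondaryDinv]
  · congr 1
    split_ifs with hc
    · rw [card_eq_one]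
      refine ⟨#C - 1, ?_⟩
      ext h
      simp only [mem_filter, mem_range, mem_singleton]
      constructor
      · intro hh
        omega
      · rintro rfl
        exact ⟨by omega, by omega, hc.2.2⟩
    · rw [card_eq_zero, filter_eq_empty_iff]
      rintro h hh ⟨h1, h2⟩
      rw [mem_range] at hh
      refine hc ⟨by omega, by omega, ?_⟩
      rwa [← h1, Nat.add_sub_cancel]
  · rw [disjoint_filter]
    intro h _ h1 h2
    omega

/-- `N` lies on top of its block. On the left, at height `#B`, it exceeds the entry of `C` there if
there is one; on the right, at height `#C`, it exceeds the entry of `B` one step lower. Two copies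
of `N` never form an inversion, so the old sizes decide. -/
theorem pairDinv_insert (N : ℕ) (B C : Finset ℕ) (hB : ∀ a ∈ B, a < N) (hC : ∀ a ∈ C, a < N)
    (p q : Prop) [Decidable p] [Decidable q] :
    pairDinv (if p then insert N B else B) (if q then insert N C else C) =
      pairDinv B C + (if p ∧ #B < #C then 1 else 0) +
        if q ∧ 0 < #C ∧ #C ≤ #B then 1 else 0 := by
  have hBN : ∀ a ∈ insert N B, a ≤ N := fun a ha => by
    rcases mem_insert.1 ha with rfl | ha
    exacts [le_rfl, (hB a ha).le]
  have hB' : ∀ a ∈ B, a ≤ N := fun a ha => (hB a ha).le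
  have hcard : #(insert N B) = #B + 1 := card_insert_of_notMem fun h => lt_irrefl _ (hB _ h)
  have e1 : (0 < #C ∧ #C ≤ #B ∧ entry B (#C - 1) < N) ↔ (0 < #C ∧ #C ≤ #B) :=
    ⟨fun h => ⟨h.1, h.2.1⟩, fun h => ⟨h.1, h.2, hB _ (entry_mem B _ (by omega))⟩⟩
  -- If `#C = #B + 1`, the entry at height `#C - 1` exists only thanks to the insertion, and it is
  -- `N` itself.
  have e2 : (0 < #C ∧ #C ≤ #(insert N B) ∧ entry (insert N B) (#C - 1) < N) ↔
      (0 < #C ∧ #C ≤ #B) := by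
    rw [hcard]
    constructor
    · rintro ⟨h1, h2, h3⟩
      refine ⟨h1, ?_⟩
      by_contra h
      have : #C - 1 = #B := by omega
      rw [this, entry_insert_card N B hB] at h3
      exact lt_irrefl _ h3
    · rintro ⟨h1, h2⟩
      refine ⟨h1, by omega, ?_⟩
      rw [entry_insert_of_lt N B hB _ (by omega)]
      exact hB _ (entry_mem B _ (by omega))
  unfold pairDinv
  by_cases hp : p <;> by_cases hq : q <;> simp only [hp, hq, if_true, if_false, true_and,
    false_and, add_zero]
  · rw [primaryDinv_insert_right N _ C hBN hC, primaryDinv_insert_left N B C hB hC,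
      secondaryDinv_insert_right N _ C hC, secondaryDinv_insert_left N B C hB hC,
      if_congr e2 rfl rfl]
    ring
  · rw [primaryDinv_insert_left N B C hB hC, secondaryDinv_insert_left N B C hB hC]
    ring
  · rw [primaryDinv_insert_right N _ C hB' hC, secondaryDinv_insert_right N _ C hC,
      if_congr e1 rfl rfl]
    ring

/-! ### Insertion statistics -/

/-- The tuple obtained by adding the letter `N` to the blocks at the positions in `T`. -/
def insertAt {x : ℕ} (N : ℕ) (T : Finset (Fin x)) (c : Fin x → Finset ℕ) : Fin x → Finset ℕ :=
  fun s => if s ∈ T then insert N (c s) else c s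

/-- The total position of the blocks of a tuple, each block being counted with weight `φ`. -/
def position {x : ℕ} (φ : Finset ℕ → ℕ) (c : Fin x → Finset ℕ) : ℕ :=
  ∑ s : Fin x, (s : ℕ) * φ (c s)

/-- The indicator of the nonempty blocks. -/
def occupied (B : Finset ℕ) : ℕ := if B.Nonempty then 1 else 0

/-- The statistic `stat` on tuples of possibly empty blocks, increased by the positions of the
nonempty blocks. -/
def shiftedStat {x : ℕ} (stat : List (Finset ℕ) → ℕ) (c : Fin x → Finset ℕ) : ℕ :=
  stat (nonemptyBlocks c) + position occupied c

/-- Inserting a new largest letter at the positions in `T` increases `I` by the sum of the ranks of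
these positions, for an order of the positions that is the usual one after the last nonempty
block. -/
def IsInsertionStat {x : ℕ} (I : (Fin x → Finset ℕ) → ℕ) : Prop :=
  I (fun _ => ∅) = 0 ∧ ∀ (N : ℕ) (c : Fin x → Finset ℕ), (∀ s, ∀ a ∈ c s, a < N) →
    ∃ ρ : Equiv.Perm (Fin x), (∀ T, I (insertAt N T c) = I c + ∑ s ∈ T, (ρ s : ℕ)) ∧
      ∀ s, (∀ t, s ≤ t → c t = ∅) → ρ s = s

/-- Ranks in a strict total order are distinct and less than `x`. This turns the increments of a
statistic, which count positions, into a permutation. -/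
theorem exists_perm_rank {x : ℕ} (r : Fin x → Fin x → Prop) [DecidableRel r]
    (irrefl : ∀ s, ¬ r s s) (trans : ∀ s t u, r s t → r t u → r s u)
    (total : ∀ s t, s ≠ t → r s t ∨ r t s) :
    ∃ ρ : Equiv.Perm (Fin x), ∀ s, (ρ s : ℕ) = #{t | r t s} := by
  have hlt : ∀ s, #{t | r t s} < x := by
    intro s
    calc #{t | r t s} < #(univ : Finset (Fin x)) :=
          card_lt_card ⟨filter_subset _ _, fun h => irrefl s (mem_filter.1 (h (mem_univ s))).2⟩
      _ = x := by simp
  have hmono : ∀ s t, r s t → #{u | r u s} < #{u | r u t} := by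
    intro s t h
    refine card_lt_card ⟨fun u hu => ?_, fun hs => ?_⟩
    · rw [mem_filter] at hu ⊢
      exact ⟨hu.1, trans _ _ _ hu.2 h⟩
    · exact irrefl s (mem_filter.1 (hs (mem_filter.2 ⟨mem_univ s, h⟩))).2
  let f : Fin x → Fin x := fun s => ⟨#{t | r t s}, hlt s⟩
  have hf : Function.Injective f := by
    intro s t h
    by_contra hne
    have h' : #{u | r u s} = #{u | r u t} := congrArg Fin.val h
    rcases total s t hne with h1 | h1
    · exact (hmono _ _ h1).ne h'
    · exact (hmono _ _ h1).ne' h'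
  exact ⟨Equiv.ofBijective f (Finite.injective_iff_bijective.1 hf), fun s => rfl⟩

theorem card_filter_lt {x : ℕ} (s : Fin x) : #{t : Fin x | t < s} = s := by
  rw [← Fin.card_Iio s]
  congr 1
  ext t
  simp

/-- The reference statistic with which `inv` and `dinv` are compared. -/
theorem isInsertionStat_position_card {x : ℕ} :
    IsInsertionStat (position card : (Fin x → Finset ℕ) → ℕ) := by
  refine ⟨by simp [position], fun N c hc => ⟨Equiv.refl _, fun T => ?_, fun s _ => rfl⟩⟩
  have : ∀ s, #(insertAt N T c s) = #(c s) + if s ∈ T then 1 else 0 := by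
    intro s
    unfold insertAt
    split_ifs
    · exact card_insert_of_notMem fun h => lt_irrefl _ (hc s _ h)
    · rfl
  simp [position, this, mul_add, sum_add_distrib]

/-- Only an empty block becomes newly occupied, and it then gains its position `s`. Writing `s` as a
number of positions lets it merge with the inversion counts into a rank. -/
theorem position_occupied_insertAt {x : ℕ} (N : ℕ) (T : Finset (Fin x)) (c : Fin x → Finset ℕ) :
    position occupied (insertAt N T c) =
      position occupied c + ∑ s ∈ T, #{t | t < s ∧ c s = ∅} := by
  have h : ∀ s : Fin x, (s : ℕ) * occupied (insertAt N T c s) =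
      s * occupied (c s) + if s ∈ T then #{t | t < s ∧ c s = ∅} else 0 := by
    intro s
    unfold insertAt occupied
    by_cases hs : s ∈ T
    · by_cases he : c s = ∅
      · simp [hs, he, card_filter_lt]
      · simp [hs, he, Finset.nonempty_iff_ne_empty.2 he]
    · simp [hs]
  rw [position, sum_congr rfl fun s _ => h s, sum_add_distrib, sum_ite_mem, univ_inter, position]

theorem sum_pairs_left {x : ℕ} (T : Finset (Fin x)) (p : Fin x → Fin x → Prop) [DecidableRel p] :
    (∑ i, ∑ j, if i < j then (if i ∈ T ∧ p i j then 1 else 0) else 0) =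
      ∑ s ∈ T, #{t | s < t ∧ p s t} := by
  rw [← univ_inter T, ← sum_ite_mem]
  refine sum_congr rfl fun i _ => ?_
  rw [card_filter]
  split_ifs with h
  · refine sum_congr rfl fun j _ => ?_
    by_cases h1 : i < j <;> simp [h1, h]
  · simp [h]

theorem sum_pairs_right {x : ℕ} (T : Finset (Fin x)) (p : Fin x → Fin x → Prop)
    [DecidableRel p] :
    (∑ i, ∑ j, if i < j then (if j ∈ T ∧ p i j then 1 else 0) else 0) =
      ∑ s ∈ T, #{t | t < s ∧ p t s} := by
  rw [sum_comm, ← univ_inter T, ← sum_ite_mem]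
  refine sum_congr rfl fun i _ => ?_
  rw [card_filter]
  split_ifs with h
  · refine sum_congr rfl fun j _ => ?_
    by_cases h1 : j < i <;> simp [h1, h]
  · simp [h]

theorem shiftedStat_pairSum {x : ℕ} (f : Finset ℕ → Finset ℕ → ℕ) (hl : ∀ B, f ∅ B = 0)
    (hr : ∀ B, f B ∅ = 0) (c : Fin x → Finset ℕ) :
    shiftedStat (pairSum f) c =
      (∑ i, ∑ j, if i < j then f (c i) (c j) else 0) + position occupied c := by
  rw [shiftedStat, pairSum_nonemptyBlocks f hl hr]

theorem card_filter_add_card_filter {x : ℕ} (p q r : Fin x → Prop) [DecidablePred p]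
    [DecidablePred q] [DecidablePred r] (hpq : ∀ t, ¬ (p t ∧ q t)) (h : ∀ t, r t ↔ p t ∨ q t) :
    #{t | p t} + #{t | q t} = #{t | r t} := by
  rw [filter_congr fun t _ => h t, filter_or, card_union_of_disjoint]
  exact disjoint_filter.2 fun t _ h1 h2 => hpq t ⟨h1, h2⟩

theorem isInsertionStat_inv {x : ℕ} :
    IsInsertionStat (shiftedStat inv : (Fin x → Finset ℕ) → ℕ) := by
  have hinv : inv = pairSum pairInv := funext inv_eq_pairSum
  rw [hinv]
  constructor
  · rw [shiftedStat_pairSum _ pairInv_empty_left pairInv_empty_right]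
    simp [pairInv_empty_left, position, occupied]
  intro N c hc
  -- The order lists the nonempty blocks from right to left, then the empty ones from left to right.
  obtain ⟨ρ, hρ⟩ := exists_perm_rank
    (fun t s : Fin x => (s < t ∧ (c t).Nonempty) ∨ (t < s ∧ c s = ∅))
    (by simp)
    (by
      intro s t u h1 h2
      simp only [Finset.nonempty_iff_ne_empty] at *
      grind)
    (by
      intro s t hst
      simp only [Finset.nonempty_iff_ne_empty]
      rcases lt_or_gt_of_ne hst with h | h <;> by_cases h1 : c s = ∅ <;>
        by_cases h2 : c t = ∅ <;> simp [h, h1, h2])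
  refine ⟨ρ, fun T => ?_, fun s hs => ?_⟩
  · rw [shiftedStat_pairSum _ pairInv_empty_left pairInv_empty_right,
      shiftedStat_pairSum _ pairInv_empty_left pairInv_empty_right, position_occupied_insertAt]
    have h : ∀ i j, (if i < j then pairInv (insertAt N T c i) (insertAt N T c j) else 0) =
        (if i < j then pairInv (c i) (c j) else 0) +
          if i < j then (if i ∈ T ∧ (c j).Nonempty then 1 else 0) else 0 := by
      intro i j
      by_cases h1 : i < j
      · simp only [h1, if_true]
        exact pairInv_insert N _ _ (hc _) (hc _) _ _
      · simp [h1]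
    simp only [h, sum_add_distrib]
    rw [sum_pairs_left T fun _ j => (c j).Nonempty]
    have h2 : ∑ s ∈ T, (ρ s : ℕ) = ∑ s ∈ T, #{t | s < t ∧ (c t).Nonempty} +
        ∑ s ∈ T, #{t | t < s ∧ c s = ∅} := by
      rw [← sum_add_distrib]
      refine sum_congr rfl fun s _ => ?_
      rw [hρ]
      exact (card_filter_add_card_filter _ _ _ (fun t ht => lt_asymm ht.1.1 ht.2.1)
        fun t => Iff.rfl).symm
    rw [h2]
    ring
  · refine Fin.ext ((hρ s).trans ?_)
    rw [← card_filter_lt s]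
    congr 1
    ext t
    simp only [mem_filter, mem_univ, true_and, hs s le_rfl, and_true]
    constructor
    · rintro (h | h)
      · rw [hs t h.1.le] at h
        simp at h
      · exact h
    · exact Or.inr

theorem isInsertionStat_dinv {x : ℕ} :
    IsInsertionStat (shiftedStat dinv : (Fin x → Finset ℕ) → ℕ) := by
  have hdinv : dinv = pairSum pairDinv := funext dinv_eq_pairSum
  rw [hdinv]
  constructor
  · rw [shiftedStat_pairSum _ pairDinv_empty_left pairDinv_empty_right]
    simp [pairDinv_empty_left, position, occupied]
  intro N c hc
  -- The order lists the blocks by decreasing size, and blocks of equal size from left to right.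
  obtain ⟨ρ, hρ⟩ := exists_perm_rank
    (fun t s : Fin x => (s < t ∧ #(c s) < #(c t)) ∨ (t < s ∧ #(c s) ≤ #(c t)))
    (by simp) (by intro s t u h1 h2; rcases eq_or_ne s u with rfl | h <;> omega)
    (by intro s t hst; omega)
  refine ⟨ρ, fun T => ?_, fun s hs => ?_⟩
  · rw [shiftedStat_pairSum _ pairDinv_empty_left pairDinv_empty_right,
      shiftedStat_pairSum _ pairDinv_empty_left pairDinv_empty_right, position_occupied_insertAt]
    have h : ∀ i j, (if i < j then pairDinv (insertAt N T c i) (insertAt N T c j) else 0) =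
        (if i < j then pairDinv (c i) (c j) else 0) +
          (if i < j then (if i ∈ T ∧ #(c i) < #(c j) then 1 else 0) else 0) +
          if i < j then (if j ∈ T ∧ 0 < #(c j) ∧ #(c j) ≤ #(c i) then 1 else 0) else 0 := by
      intro i j
      by_cases h1 : i < j
      · simp only [h1, if_true]
        exact pairDinv_insert N _ _ (hc _) (hc _) _ _
      · simp [h1]
    simp only [h, sum_add_distrib]
    rw [sum_pairs_left T fun i j => #(c i) < #(c j),
      sum_pairs_right T fun i j => 0 < #(c j) ∧ #(c j) ≤ #(c i)]
    have h2 : ∑ s ∈ T, (ρ s : ℕ) = ∑ s ∈ T, #{t | s < t ∧ #(c s) < #(c t)} +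
        (∑ s ∈ T, #{t | t < s ∧ 0 < #(c s) ∧ #(c s) ≤ #(c t)} +
          ∑ s ∈ T, #{t | t < s ∧ c s = ∅}) := by
      rw [← sum_add_distrib, ← sum_add_distrib]
      refine sum_congr rfl fun s _ => ?_
      -- Secondary inversions account for the nonempty blocks `c s`, the shift by positions for the
      -- empty ones.
      rw [hρ, card_filter_add_card_filter (fun t => t < s ∧ 0 < #(c s) ∧ #(c s) ≤ #(c t))
          (fun t => t < s ∧ c s = ∅) (fun t => t < s ∧ #(c s) ≤ #(c t))]
      · exact (card_filter_add_card_filter _ _ _ (fun t ht => lt_asymm ht.1.1 ht.2.1)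
          fun t => Iff.rfl).symm
      · rintro t ⟨h1, h2⟩
        simp [h2.2] at h1
      · intro t
        rw [← card_eq_zero]
        omega
    rw [h2]
    ring
  · refine Fin.ext ((hρ s).trans ?_)
    rw [← card_filter_lt s]
    congr 1
    ext t
    simp only [mem_filter, mem_univ, true_and, hs s le_rfl, card_empty, zero_le, and_true]
    constructor
    · rintro (h | h)
      · rw [hs t h.1.le] at h
        simp at h
      · exact h
    · exact Or.inr

/-! ### The condition on the letter `0` -/

/-- Every block that contains `0` is followed by a nonempty block. -/
def ZeroFree {x : ℕ} (c : Fin x → Finset ℕ) : Prop :=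
  ∀ s, 0 ∈ c s → ∃ t, s < t ∧ (c t).Nonempty

/-- The number of positions up to the last nonempty block. -/
def reach {x : ℕ} (c : Fin x → Finset ℕ) : ℕ :=
  univ.sup fun s => if (c s).Nonempty then (s : ℕ) + 1 else 0

theorem lt_reach {x : ℕ} (c : Fin x → Finset ℕ) (s : Fin x) (h : (c s).Nonempty) :
    (s : ℕ) < reach c := by
  have := Finset.le_sup (f := fun s : Fin x => if (c s).Nonempty then (s : ℕ) + 1 else 0)
    (mem_univ s)
  simp only [h, if_true] at this
  exact this

theorem reach_le_iff {x : ℕ} (c : Fin x → Finset ℕ) (n : ℕ) :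
    reach c ≤ n ↔ ∀ s, (c s).Nonempty → (s : ℕ) < n := by
  rw [reach, Finset.sup_le_iff]
  refine forall_congr' fun s => ?_
  split_ifs with h <;> simp [h]

theorem insertAt_nonempty {x : ℕ} (N : ℕ) (T : Finset (Fin x)) (c : Fin x → Finset ℕ)
    (s : Fin x) : (insertAt N T c s).Nonempty ↔ s ∈ T ∨ (c s).Nonempty := by
  unfold insertAt
  split_ifs with h <;> simp [h]

theorem reach_insertAt {x : ℕ} (N : ℕ) (T : Finset (Fin x)) (c : Fin x → Finset ℕ) :
    reach (insertAt N T c) = max (reach c) (T.sup fun s => (s : ℕ) + 1) := by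
  refine eq_of_forall_ge_iff fun n => ?_
  rw [reach_le_iff, max_le_iff, reach_le_iff, Finset.sup_le_iff]
  simp only [insertAt_nonempty, Nat.succ_le_iff]
  exact ⟨fun h => ⟨fun s hs => h s (Or.inr hs), fun s hs => h s (Or.inl hs)⟩,
    fun h s hs => hs.elim (h.2 s) (h.1 s)⟩

/-- The condition fails only when the last nonempty block contains `0`; a nonzero letter repairs
this exactly when it is put beyond that block. -/
theorem zeroFree_insertAt {x : ℕ} (N : ℕ) (hN : N ≠ 0) (T : Finset (Fin x))
    (c : Fin x → Finset ℕ) :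
    ZeroFree (insertAt N T c) ↔ ZeroFree c ∨ ∃ t ∈ T, reach c ≤ t := by
  have hmem : ∀ s, 0 ∈ insertAt N T c s ↔ 0 ∈ c s := by
    intro s
    unfold insertAt
    split_ifs <;> simp [hN.symm]
  simp only [ZeroFree, hmem, insertAt_nonempty]
  constructor
  · intro h
    by_contra hcon
    push Not at hcon
    obtain ⟨⟨s, hs, hlast⟩, hT⟩ := hcon
    obtain ⟨t, hst, ht | ht⟩ := h s hs
    · refine absurd (hT t ht) (not_lt.2 ?_)
      rw [reach_le_iff]
      intro u hu
      by_contra htu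
      have : s < u := by omega
      exact hu.ne_empty (hlast u this)
    · exact ht.ne_empty (hlast t hst)
  · rintro (h | ⟨t, ht, hle⟩) s hs
    · obtain ⟨t, hst, ht⟩ := h s hs
      exact ⟨t, hst, Or.inr ht⟩
    · exact ⟨t, Fin.lt_def.2 ((lt_reach c s ⟨0, hs⟩).trans_le hle), Or.inl ht⟩

theorem zeroFree_insertAt_zero {x : ℕ} (T : Finset (Fin x)) (c : Fin x → Finset ℕ)
    (hc : ∀ s, c s = ∅) : ZeroFree (insertAt 0 T c) ↔ T = ∅ := by
  constructor
  · intro h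
    by_contra hT
    have hT' := Finset.nonempty_iff_ne_empty.2 hT
    obtain ⟨t, hlt, ht⟩ := h (T.max' hT') (by simp [insertAt, T.max'_mem hT'])
    rw [insertAt_nonempty, hc] at ht
    exact absurd (T.le_max' t (by simpa using ht)) (not_le.2 hlt)
  · rintro rfl s hs
    simp [insertAt, hc] at hs

/-! ### Equidistribution of insertion statistics -/

/-- The tuples of `x` blocks in which the letters `a < M` have the multiplicities `b a` and no
other letters occur. -/
def tuples (b : ℕ → ℕ) (M x : ℕ) : Finset (Fin x → Finset ℕ) :=
  (Fintype.piFinset fun _ => (range M).powerset).filter fun c => ∀ a < M, #{s | a ∈ c s} = b a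

theorem mem_tuples {b : ℕ → ℕ} {M x : ℕ} {c : Fin x → Finset ℕ} :
    c ∈ tuples b M x ↔ (∀ s, ∀ a ∈ c s, a < M) ∧ ∀ a < M, #{s | a ∈ c s} = b a := by
  simp [tuples, Finset.subset_iff]

theorem tuples_zero (b : ℕ → ℕ) (x : ℕ) : tuples b 0 x = {fun _ => ∅} := by
  ext c
  simp only [mem_tuples, not_lt_zero, IsEmpty.forall_iff, implies_true, and_true, mem_singleton,
    funext_iff, imp_false, Finset.eq_empty_iff_forall_notMem]

theorem sum_tuples_succ (b : ℕ → ℕ) (M x : ℕ) (f : (Fin x → Finset ℕ) → ℤ[X]) :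
    ∑ c ∈ tuples b (M + 1) x, f c =
      ∑ c ∈ tuples b M x, ∑ T ∈ powersetCard (b M) univ, f (insertAt M T c) := by
  rw [← Finset.sum_product']
  refine Finset.sum_nbij' (fun c => (fun s => (c s).erase M, univ.filter fun s => M ∈ c s))
    (fun p => insertAt M p.2 p.1) ?_ ?_ ?_ ?_ ?_
  · intro c hc
    rw [mem_tuples] at hc
    simp only [mem_product, mem_tuples, mem_powersetCard_univ, mem_erase]
    refine ⟨⟨fun s a ha => ?_, fun a ha => ?_⟩, hc.2 M (Nat.lt_succ_self M)⟩
    · have := hc.1 s a ha.2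
      omega
    · rw [← hc.2 a (by omega)]
      simp [ha.ne]
  · rintro ⟨c, T⟩ h
    simp only [mem_product, mem_tuples, mem_powersetCard_univ] at h
    obtain ⟨⟨h1, h2⟩, h3⟩ := h
    rw [mem_tuples]
    constructor
    · intro s a ha
      unfold insertAt at ha
      split_ifs at ha with hs
      · rcases mem_insert.1 ha with rfl | ha
        exacts [Nat.lt_succ_self _, (h1 s a ha).trans (Nat.lt_succ_self _)]
      · exact (h1 s a ha).trans (Nat.lt_succ_self _)
    · intro a ha
      rcases Nat.lt_succ_iff_lt_or_eq.1 ha with ha | rfl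
      · rw [← h2 a ha]
        congr 1
        ext s
        unfold insertAt
        by_cases hs : s ∈ T <;> simp [hs, ha.ne]
      · rw [← h3]
        congr 1
        ext s
        unfold insertAt
        have : a ∉ c s := fun h => lt_irrefl _ (h1 s a h)
        by_cases hs : s ∈ T <;> simp [this, hs]
  · intro c _
    funext s
    unfold insertAt
    by_cases h : M ∈ c s <;> simp [h]
  · rintro ⟨c, T⟩ h
    simp only [mem_product, mem_tuples] at h
    have hM : ∀ s, M ∉ c s := fun s hs => lt_irrefl _ (h.1.1 s M hs)
    refine Prod.ext (funext fun s => ?_) ?_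
    · by_cases hs : s ∈ T <;> simp [insertAt, hs, hM]
    · ext s
      by_cases hs : s ∈ T <;> simp [insertAt, hs, hM]
  · intro c _
    congr 1
    funext s
    unfold insertAt
    by_cases h : M ∈ c s <;> simp [h]

/-- All insertion statistics are equidistributed, jointly with the end of the tuple. -/
theorem IsInsertionStat.sum_eq {x : ℕ} {I J : (Fin x → Finset ℕ) → ℕ} (hI : IsInsertionStat I)
    (hJ : IsInsertionStat J) (b : ℕ → ℕ) (M : ℕ) (Ψ : ℕ → Prop → ℤ[X]) :
    ∑ c ∈ tuples b M x, Ψ (reach c) (ZeroFree c) * X ^ I c =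
      ∑ c ∈ tuples b M x, Ψ (reach c) (ZeroFree c) * X ^ J c := by
  induction M generalizing Ψ with
  | zero => simp [tuples_zero, hI.1, hJ.1]
  | succ M ih =>
    -- Summing out the letter `M` leaves a weight of the same kind, independent of the statistic;
    -- this is why the induction runs over all `Ψ`. For `M = 0` all blocks are empty beforehand, so
    -- `p` plays no role.
    let Φ : ℕ → Prop → ℤ[X] := fun u p => ∑ T ∈ powersetCard (b M) (univ : Finset (Fin x)),
      Ψ (max u (T.sup fun s => (s : ℕ) + 1))
        (if M = 0 then T = ∅ else p ∨ ∃ t ∈ T, u ≤ t) * X ^ (∑ s ∈ T, (s : ℕ))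
    have key : ∀ {K : (Fin x → Finset ℕ) → ℕ}, IsInsertionStat K →
        ∑ c ∈ tuples b (M + 1) x, Ψ (reach c) (ZeroFree c) * X ^ K c =
          ∑ c ∈ tuples b M x, Φ (reach c) (ZeroFree c) * X ^ K c := by
      intro K hK
      rw [sum_tuples_succ]
      refine sum_congr rfl fun c hc => ?_
      rw [mem_tuples] at hc
      obtain ⟨ρ, hρ, hfix⟩ := hK.2 M c hc.1
      have hfix' : ∀ s : Fin x, reach c ≤ s → ρ s = s := by
        intro s hs
        refine hfix s fun t hst => ?_
        by_contra hne
        have := lt_reach c t (Finset.nonempty_iff_ne_empty.2 hne)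
        omega
      -- Fixing every position from `reach c` on, the permutation also preserves the set of those
      -- before it.
      have hiff : ∀ s : Fin x, reach c ≤ ρ s ↔ reach c ≤ s := by
        intro s
        constructor
        · intro h
          have := ρ.injective (hfix' _ h)
          rwa [this] at h
        · intro h
          rwa [hfix' s h]
      simp only [Φ, sum_mul]
      -- Replacing `T` by its image under `ρ` turns the ranks into positions.
      refine Finset.sum_bij (fun T _ => T.map ρ.toEmbedding) ?_ ?_ ?_ ?_
      · intro T hT
        simpa using hT
      · intro T _ T' _ h
        exact map_injective _ h
      · intro T hT
        exact ⟨T.map ρ.symm.toEmbedding, by simpa using hT, by ext; simp⟩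
      · intro T _
        have h1 : reach (insertAt M T c) =
            max (reach c) ((T.map ρ.toEmbedding).sup fun s => (s : ℕ) + 1) := by
          rw [reach_insertAt, sup_map]
          refine eq_of_forall_ge_iff fun n => ?_
          simp only [max_le_iff, Finset.sup_le_iff, Function.comp_apply,
            Equiv.coe_toEmbedding, Nat.succ_le_iff]
          refine and_congr_right fun hn => forall₂_congr fun s _ => ?_
          by_cases h : reach c ≤ s
          · rw [hfix' s h]
          · have h' := mt (hiff s).1 h
            exact ⟨fun _ => by omega, fun _ => by omega⟩
        have h2 : ZeroFree (insertAt M T c) = (if M = 0 then T.map ρ.toEmbedding = ∅ else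
            ZeroFree c ∨ ∃ t ∈ T.map ρ.toEmbedding, reach c ≤ t) := by
          split_ifs with hM
          · subst hM
            rw [zeroFree_insertAt_zero T c fun s => by
              simpa [Finset.eq_empty_iff_forall_notMem] using hc.1 s]
            simp
          · rw [zeroFree_insertAt M hM]
            simp only [mem_map, Equiv.coe_toEmbedding, exists_exists_and_eq_and, hiff]
        rw [h1, h2, hρ, sum_map, pow_add]
        simp only [Equiv.coe_toEmbedding]
        ring
    rw [key hI, key hJ, ih]

/-! ### Gaussian binomials and placements of equal weights -/

/-- The Gaussian binomial coefficients. -/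
noncomputable def qBinom : ℕ → ℕ → ℤ[X]
  | _, 0 => 1
  | 0, _ + 1 => 0
  | n + 1, k + 1 => X ^ (k + 1) * qBinom n (k + 1) + qBinom n k

@[simp] theorem qBinom_zero_right (n : ℕ) : qBinom n 0 = 1 := by cases n <;> rw [qBinom]

theorem qBinom_succ_succ (n k : ℕ) :
    qBinom (n + 1) (k + 1) = X ^ (k + 1) * qBinom n (k + 1) + qBinom n k := by rw [qBinom]

theorem qBinom_eq_zero (n k : ℕ) (h : n < k) : qBinom n k = 0 := by
  induction n generalizing k with
  | zero => cases k with
    | zero => simp at h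
    | succ k => rw [qBinom]
  | succ n ih => cases k with
    | zero => simp at h
    | succ k => rw [qBinom_succ_succ, ih _ (by omega), ih _ (by omega), mul_zero, add_zero]

/-- The ratios of neighbouring Gaussian binomials, with denominators cleared and with powers of `X`
that avoid the exponent `n - k`. The inductive step needs both identities. -/
theorem qBinom_succ_right_mul (n k : ℕ) :
    X ^ k * (X ^ (k + 1) - 1) * qBinom n (k + 1) = (X ^ n - X ^ k) * qBinom n k ∧
      (X ^ (n + 1) - X ^ k) * qBinom (n + 1) k = X ^ k * (X ^ (n + 1) - 1) * qBinom n k := by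
  induction n generalizing k with
  | zero =>
    rcases k with _ | _ | k
    · simp [qBinom_eq_zero]
    · simp [qBinom_eq_zero, qBinom_succ_succ]
    · simp [qBinom_eq_zero]
  | succ n ih =>
    have h1 : X ^ k * (X ^ (k + 1) - 1) * qBinom (n + 1) (k + 1) =
        (X ^ (n + 1) - X ^ k) * qBinom (n + 1) k := by
      rw [(ih k).2, qBinom_succ_succ]
      linear_combination X ^ (k + 1) * (ih k).1
    refine ⟨h1, ?_⟩
    cases k with
    | zero => simp
    | succ k =>
      have h0 : X ^ k * (X ^ (k + 1) - 1) * qBinom (n + 1) (k + 1) =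
          (X ^ (n + 1) - X ^ k) * qBinom (n + 1) k := by
        rw [(ih k).2, qBinom_succ_succ]
        linear_combination X ^ (k + 1) * (ih k).1
      rw [qBinom_succ_succ (n + 1) k]
      linear_combination (-X) * h0

/-- The second Pascal rule; the factor `X ^ k` avoids a truncated `n - k`. -/
theorem qBinom_succ_succ' (n k : ℕ) :
    X ^ k * qBinom (n + 1) (k + 1) = X ^ k * qBinom n (k + 1) + X ^ n * qBinom n k := by
  rw [qBinom_succ_succ]
  linear_combination (qBinom_succ_right_mul n k).1

theorem placements_replicate_succ (k x : ℕ) :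
    placements (List.replicate (k + 1) 1) (x + 1) =
      X ^ (k + 1) * placements (List.replicate (k + 1) 1) x +
        X ^ k * placements (List.replicate k 1) x := by
  rw [List.replicate_succ, placements_cons_succ]
  simp [add_comm]

/-- Here the last position `x` is free or occupied; in `placements_replicate_succ` it is position 0
that is free or occupied. -/
theorem placements_replicate_succ' (k x : ℕ) :
    placements (List.replicate (k + 1) 1) (x + 1) =
      placements (List.replicate (k + 1) 1) x + X ^ x * placements (List.replicate k 1) x := by
  induction x generalizing k with
  | zero =>
    rw [placements_replicate_succ, placements_eq_zero _ _ (by simp)]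
    cases k with
    | zero => simp
    | succ k => rw [placements_eq_zero (List.replicate (k + 1) 1) 0 (by simp)]; simp
  | succ x ih =>
    rw [placements_replicate_succ k (x + 1)]
    cases k with
    | zero =>
      have h0 := placements_replicate_succ 0 x
      have h1 := ih 0
      simp only [List.replicate_zero, placements_nil] at *
      linear_combination X * h1 - h0
    | succ k =>
      linear_combination X ^ (k + 2) * ih (k + 1) + X ^ (k + 1) * ih k -
        placements_replicate_succ (k + 1) x - X ^ (x + 1) * placements_replicate_succ k x

/-! ### Descents and the major index -/

/-- The letter `a` is larger than the first letter of `σ`. -/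
def HeadLT (σ : List ℕ) (a : ℕ) : Prop := ∃ b ∈ σ.head?, b < a

/-- The number of descents of a word. -/
noncomputable def des : List ℕ → ℕ
  | [] => 0
  | a :: σ => open Classical in des σ + if HeadLT σ a then 1 else 0

theorem des_lt_length (σ : List ℕ) (h : σ ≠ []) : des σ < σ.length := by
  induction σ with
  | nil => simp at h
  | cons a σ ih =>
    cases σ with
    | nil => simp [des, HeadLT]
    | cons b σ =>
      have := ih (by simp)
      rw [des, List.length_cons]
      split_ifs <;> omega

/-- The sum of the entries of `ι` to the right of the descents of `σ`. -/
def descentSum (σ ι : List ℕ) : ℕ :=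
  ∑ i ∈ (Finset.range (σ.length - 1)).filter (fun i => σ.getD i 0 > σ.getD (i + 1) 0),
    ι.getD (i + 1) 0

open Classical in
theorem descentSum_cons (a i : ℕ) (σ ι : List ℕ) :
    descentSum (a :: σ) (i :: ι) =
      descentSum σ ι + if HeadLT σ a then ι.getD 0 0 else 0 := by
  cases σ with
  | nil => simp [descentSum, HeadLT]
  | cons b σ =>
    simp only [descentSum, sum_filter, List.length_cons, Nat.add_sub_cancel]
    rw [sum_range_succ']
    simp [HeadLT]

theorem descentSum_map_succ (σ ι : List ℕ) (h : σ.length = ι.length) :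
    descentSum σ (ι.map (· + 1)) = descentSum σ ι + des σ := by
  induction σ generalizing ι with
  | nil => simp [descentSum, des]
  | cons a σ ih =>
    cases ι with
    | nil => simp at h
    | cons i ι =>
      simp only [List.length_cons, Nat.add_right_cancel_iff] at h
      rw [List.map_cons, descentSum_cons, descentSum_cons, des, ih ι h]
      split_ifs with hd
      -- The default value of `getD` does not increase with the map, but for empty `ι` there is no
      -- descent at the head.
      · cases ι with
        | nil =>
          rw [List.length_nil, List.length_eq_zero_iff] at h
          simp [h, HeadLT] at hd
        | cons j ι => simp; ring
      · ring

theorem maj_eq_descentSum (π : List (Finset ℕ)) : maj π = descentSum (word π) (ind π) := rfl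

theorem word_cons (B : Finset ℕ) (π : List (Finset ℕ)) :
    word (B :: π) = B.sort (fun a b => a ≥ b) ++ word π := by
  simp [word]

theorem ind_cons (B : Finset ℕ) (π : List (Finset ℕ)) :
    ind (B :: π) = List.replicate #B 0 ++ (ind π).map (· + 1) := by
  simp [ind, List.zipIdx_cons, List.zipIdx_succ, List.flatMap_map, List.map_flatMap]

theorem length_word (π : List (Finset ℕ)) : (word π).length = (π.map card).sum := by
  induction π with
  | nil => simp [word]
  | cons B π ih => simp [word_cons, ih]

theorem length_ind (π : List (Finset ℕ)) : (ind π).length = (π.map card).sum := by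
  induction π with
  | nil => simp [ind]
  | cons B π ih => simp [ind_cons, ih]

theorem sort_ge_insert (a : ℕ) (B : Finset ℕ) (hB : ∀ b ∈ B, b < a) :
    (insert a B).sort (fun a b => a ≥ b) = a :: B.sort (fun a b => a ≥ b) := by
  have ha : a ∉ B := fun h => lt_irrefl _ (hB a h)
  refine List.Perm.eq_of_pairwise' (r := fun a b : ℕ => a ≥ b) (Finset.pairwise_sort _ _) ?_ ?_
  · rw [List.pairwise_cons]
    exact ⟨fun b hb => (hB b ((Finset.mem_sort _).1 hb)).le, Finset.pairwise_sort _ _⟩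
  · rw [← Multiset.coe_eq_coe, Finset.sort_eq, ← Multiset.cons_coe, Finset.sort_eq,
      Finset.insert_val_of_notMem ha]

theorem word_insert_cons (a : ℕ) (B : Finset ℕ) (hB : ∀ b ∈ B, b < a) (π : List (Finset ℕ)) :
    word (insert a B :: π) = a :: word (B :: π) := by
  rw [word_cons, sort_ge_insert a B hB, word_cons, List.cons_append]

theorem word_singleton_cons (a : ℕ) (π : List (Finset ℕ)) :
    word ({a} :: π) = a :: word π := by
  simp [word_cons]

theorem ind_getD_zero (π : List (Finset ℕ)) (h : ∀ B ∈ π, B.Nonempty) : (ind π).getD 0 0 = 0 := by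
  cases π with
  | nil => simp [ind]
  | cons B π =>
    obtain ⟨n, hn⟩ := Nat.exists_eq_add_one.2 (card_pos.2 (h B (by simp)))
    rw [ind_cons, hn, List.replicate_succ]
    simp

open Classical in
-- A new first block raises the index of every later letter by one, so each old descent gains one; a
-- descent right after `a` also counts one.
theorem maj_singleton_cons (a : ℕ) (π : List (Finset ℕ)) (h : ∀ B ∈ π, B.Nonempty) :
    maj ({a} :: π) = maj π + des (a :: word π) := by
  have h0 := ind_getD_zero π h
  rw [maj_eq_descentSum, word_singleton_cons, ind_cons, card_singleton, List.replicate_one,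
    List.singleton_append, descentSum_cons,
    descentSum_map_succ _ _ ((length_word π).trans (length_ind π).symm), des, maj_eq_descentSum,
    add_assoc]
  congr 2
  split_ifs with hd
  · cases hι : ind π with
    | nil =>
      have := (length_word π).trans (length_ind π).symm
      rw [hι, List.length_nil, List.length_eq_zero_iff] at this
      simp [this, HeadLT] at hd
    | cons j ι =>
      rw [hι] at h0
      simpa using h0
  · rfl

/-- The new descent lies inside the first block, whose index is 0. -/
theorem maj_insert_cons (a : ℕ) (B : Finset ℕ) (hne : B.Nonempty) (hB : ∀ b ∈ B, b < a)
    (π : List (Finset ℕ)) : maj (insert a B :: π) = maj (B :: π) := by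
  have hind : ind (insert a B :: π) = 0 :: ind (B :: π) := by
    rw [ind_cons, ind_cons, card_insert_of_notMem fun h => lt_irrefl _ (hB _ h),
      List.replicate_succ, List.cons_append]
  have h0 : (ind (B :: π)).getD 0 0 = 0 := by
    obtain ⟨n, hn⟩ := Nat.exists_eq_add_one.2 (card_pos.2 hne)
    rw [ind_cons, hn, List.replicate_succ]
    simp
  rw [maj_eq_descentSum, word_insert_cons a B hB, hind, descentSum_cons, h0, ite_self, add_zero,
    maj_eq_descentSum]

/-! ### Cuttings of a fixed word -/

/-- Adds the letter `a` to the first block. -/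
def insertHead (a : ℕ) : List (Finset ℕ) → List (Finset ℕ)
  | [] => []
  | B :: π => insert a B :: π

open Classical in
/-- The sequences of nonempty blocks with word `σ`. -/
noncomputable def cuttings : List ℕ → Finset (List (Finset ℕ))
  | [] => {[]}
  | a :: σ => (cuttings σ).image (List.cons {a}) ∪
      if HeadLT σ a then (cuttings σ).image (insertHead a) else ∅

/-- The first letter of the word is the maximum of the first block. -/
theorem head_lt_of_word (π : List (Finset ℕ)) (hne : ∀ B ∈ π, B.Nonempty) (a : ℕ)
    (h : HeadLT (word π) a) : ∃ B π', π = B :: π' ∧ B.Nonempty ∧ ∀ b ∈ B, b < a := by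
  cases π with
  | nil => simp [word, HeadLT] at h
  | cons B π =>
    have hB := hne B (by simp)
    refine ⟨B, π, rfl, hB, ?_⟩
    have hmax : ∀ b ∈ B.erase (B.max' hB), b < B.max' hB := fun b hb =>
      lt_of_le_of_ne (B.le_max' b (mem_of_mem_erase hb)) (ne_of_mem_erase hb)
    have hw := word_insert_cons _ _ hmax π
    rw [insert_erase (B.max'_mem hB)] at hw
    rw [hw] at h
    obtain ⟨b, hb, hlt⟩ := h
    simp only [List.head?_cons, Option.mem_some_iff] at hb
    exact fun c hc => (B.le_max' c hc).trans_lt (hb ▸ hlt)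

theorem headLT_word_cons (a : ℕ) (B : Finset ℕ) (hne : B.Nonempty) (hB : ∀ b ∈ B, b < a)
    (π : List (Finset ℕ)) : HeadLT (word (B :: π)) a := by
  have hmax : ∀ b ∈ B.erase (B.max' hne), b < B.max' hne := fun b hb =>
    lt_of_le_of_ne (B.le_max' b (mem_of_mem_erase hb)) (ne_of_mem_erase hb)
  have hw := word_insert_cons _ _ hmax π
  rw [insert_erase (B.max'_mem hne)] at hw
  rw [hw]
  exact ⟨_, rfl, hB _ (B.max'_mem hne)⟩

theorem mem_cuttings (σ : List ℕ) (π : List (Finset ℕ)) :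
    π ∈ cuttings σ ↔ (∀ B ∈ π, B.Nonempty) ∧ word π = σ := by
  induction σ generalizing π with
  | nil =>
    rw [cuttings, mem_singleton]
    constructor
    · rintro rfl
      simp [word]
    · rintro ⟨h1, h2⟩
      cases π with
      | nil => rfl
      | cons B π =>
        have := card_pos.2 (h1 B (by simp))
        have h3 := length_word (B :: π)
        rw [h2] at h3
        simp only [List.length_nil, List.map_cons, List.sum_cons] at h3
        omega
  | cons a σ ih =>
    rw [cuttings, mem_union, mem_image]
    constructor
    · rintro (⟨π, hπ, rfl⟩ | h)
      · rw [ih] at hπ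
        refine ⟨?_, by rw [word_singleton_cons, hπ.2]⟩
        simpa using hπ.1
      · split_ifs at h with hd
        · obtain ⟨π, hπ, rfl⟩ := mem_image.1 h
          rw [ih] at hπ
          obtain ⟨hne, rfl⟩ := hπ
          obtain ⟨B, π, rfl, h1, h2⟩ := head_lt_of_word π hne a hd
          rw [insertHead, word_insert_cons a B h2]
          simp only [List.mem_cons, forall_eq_or_imp] at hne ⊢
          exact ⟨⟨insert_nonempty _ _, hne.2⟩, trivial⟩
        · simp at h
    · rintro ⟨hne, hw⟩
      cases π with
      | nil => simp [word] at hw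
      | cons B π =>
        have hB := hne B (by simp)
        have hmax : ∀ b ∈ B.erase (B.max' hB), b < B.max' hB := fun b hb =>
          lt_of_le_of_ne (B.le_max' b (mem_of_mem_erase hb)) (ne_of_mem_erase hb)
        have hi := insert_erase (B.max'_mem hB)
        generalize B.max' hB = c at *
        generalize B.erase c = C at *
        subst hi
        rw [word_insert_cons _ _ hmax, List.cons.injEq] at hw
        obtain ⟨rfl, rfl⟩ := hw
        simp only [List.mem_cons, forall_eq_or_imp] at hne
        rcases C.eq_empty_or_nonempty with rfl | hC
        · refine Or.inl ⟨π, (ih π).2 ⟨hne.2, ?_⟩, rfl⟩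
          simp [word]
        · refine Or.inr ?_
          rw [if_pos (headLT_word_cons c C hC hmax π)]
          refine mem_image.2 ⟨C :: π, (ih _).2 ⟨?_, rfl⟩, rfl⟩
          simpa using ⟨hC, hne.2⟩

-- The letter `a` is either alone in the first block or joins a nonempty block of smaller letters,
-- so the two cases are disjoint and each is injective.
open Classical in
theorem sum_cuttings_cons (a : ℕ) (σ : List ℕ) (f : List (Finset ℕ) → ℤ[X]) :
    ∑ π ∈ cuttings (a :: σ), f π = ∑ π ∈ cuttings σ, f ({a} :: π) +
      if HeadLT σ a then ∑ π ∈ cuttings σ, f (insertHead a π) else 0 := by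
  have hsing : ∑ π ∈ (cuttings σ).image (List.cons {a}), f π =
      ∑ π ∈ cuttings σ, f ({a} :: π) :=
    sum_image fun π _ π' _ h => by simpa using h
  rw [cuttings]
  split_ifs with hd
  · have hform : ∀ π ∈ cuttings σ, ∃ B π', π = B :: π' ∧ B.Nonempty ∧ ∀ b ∈ B, b < a := by
      intro π hπ
      rw [mem_cuttings] at hπ
      exact head_lt_of_word π hπ.1 a (hπ.2 ▸ hd)
    rw [sum_union, hsing, sum_image]
    · intro π hπ π' hπ' h
      obtain ⟨B, π, rfl, h1, h2⟩ := hform π hπ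
      obtain ⟨B', π', rfl, h1', h2'⟩ := hform π' hπ'
      simp only [insertHead, List.cons.injEq] at h
      rw [← erase_insert fun h => lt_irrefl _ (h2 a h), h.1,
        erase_insert fun h => lt_irrefl _ (h2' a h), h.2]
    · rw [disjoint_left]
      rintro _ h h'
      obtain ⟨π, hπ, rfl⟩ := mem_image.1 h
      obtain ⟨π', hπ', he⟩ := mem_image.1 h'
      obtain ⟨B, π', rfl, ⟨b, hb⟩, h2⟩ := hform π' hπ'
      simp only [insertHead, List.cons.injEq] at he
      have : b ∈ insert a B := mem_insert_of_mem hb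
      rw [he.1, mem_singleton] at this
      exact (h2 b hb).ne this
  · rw [union_empty, hsing, add_zero]

open Classical in
/-- The smallest exponent in the generating function of the placements of the cuttings. -/
noncomputable def lowDegree : List ℕ → ℕ
  | [] => 0
  | a :: σ => lowDegree σ + if HeadLT σ a then 0 else σ.length

/-- Giving each letter the position of its block yields sequences `p₁ ≤ ⋯ ≤ pₙ < x` that increase
strictly at the non-descents of `σ`. Removing the forced gaps accounts for `lowDegree σ` and leaves
the Gaussian binomial. The proof verifies this by Pascal's rule. -/
theorem sum_cuttings_placements_card (σ : List ℕ) (x : ℕ) :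
    ∑ π ∈ cuttings σ, placements (π.map card) x =
      X ^ lowDegree σ * qBinom (x + des σ) σ.length := by
  induction σ generalizing x with
  | nil => simp [cuttings, lowDegree]
  | cons a σ ih =>
    have hlen : ∀ π ∈ cuttings σ, (π.map card).sum = σ.length := by
      intro π hπ
      rw [← ((mem_cuttings _ _).1 hπ).2, length_word]
    induction x with
    | zero =>
      rw [zero_add, qBinom_eq_zero _ _ (des_lt_length _ (by simp)), mul_zero]
      refine sum_eq_zero fun π hπ => ?_
      rw [mem_cuttings] at hπ
      cases π with
      | nil => simp [word] at hπ
      | cons B π => simp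
    | succ x ihx =>
      have h1 : ∀ π ∈ cuttings σ, placements (({a} :: π).map card) (x + 1) =
          X ^ (σ.length + 1) * placements (({a} :: π).map card) x +
            X ^ σ.length * placements (π.map card) x := by
        intro π hπ
        rw [List.map_cons, placements_cons_succ, hlen π hπ, card_singleton, add_comm 1]
      rw [sum_cuttings_cons, sum_congr rfl h1, sum_add_distrib, ← mul_sum, ← mul_sum, ih]
      rw [sum_cuttings_cons] at ihx
      simp only [des, lowDegree, List.length_cons] at ihx ⊢
      by_cases hd : HeadLT σ a
      · simp only [hd, if_true, add_zero] at ihx ⊢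
        -- The last two terms isolate the placements with the first block at position 0, where its
        -- size carries no weight.
        have h2 : ∀ π ∈ cuttings σ, placements ((insertHead a π).map card) (x + 1) =
            X ^ (σ.length + 1) * placements ((insertHead a π).map card) x +
              placements (π.map card) (x + 1) - X ^ σ.length * placements (π.map card) x := by
          intro π hπ
          have hl := hlen π hπ
          rw [mem_cuttings] at hπ
          obtain ⟨B, π, rfl, h1, h2⟩ := head_lt_of_word π hπ.1 a (hπ.2 ▸ hd)
          simp only [insertHead, List.map_cons, placements_cons_succ]
          rw [card_insert_of_notMem fun h => lt_irrefl _ (h2 a h), ← hl, List.map_cons,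
            List.sum_cons]
          ring
        rw [sum_congr rfl h2, sum_sub_distrib, sum_add_distrib, ← mul_sum, ← mul_sum, ih, ih]
        rw [← add_assoc x (des σ) 1] at ihx
        rw [show x + 1 + (des σ + 1) = x + des σ + 1 + 1 by ring, qBinom_succ_succ,
          show x + 1 + des σ = x + des σ + 1 by ring]
        linear_combination X ^ (σ.length + 1) * ihx
      · simp only [hd, if_false, add_zero] at ihx ⊢
        rw [show x + 1 + des σ = x + des σ + 1 by ring, qBinom_succ_succ]
        linear_combination X ^ (σ.length + 1) * ihx

/-- A separate block `{a}` adds `des (a :: σ)` to `maj` and one block; joining the first block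
changes neither `maj` nor the number of blocks. The recursion in the last position then matches the
second Pascal rule. -/
theorem sum_cuttings_maj (σ : List ℕ) (x : ℕ) :
    ∑ π ∈ cuttings σ, X ^ maj π * placements (List.replicate π.length 1) x =
      X ^ lowDegree σ * qBinom (x + des σ) σ.length := by
  induction σ generalizing x with
  | nil => simp [cuttings, lowDegree, maj_eq_descentSum, word, descentSum]
  | cons a σ ih =>
    have h1 : ∀ x, ∀ π ∈ cuttings σ,
        X ^ maj ({a} :: π) * placements (List.replicate ({a} :: π).length 1) x =
          X ^ des (a :: σ) * (X ^ maj π * placements (List.replicate (π.length + 1) 1) x) := by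
      intro x π hπ
      rw [mem_cuttings] at hπ
      rw [maj_singleton_cons a π hπ.1, hπ.2, pow_add, List.length_cons]
      ring
    have h2 : ∑ π ∈ cuttings σ, X ^ maj π * placements (List.replicate (π.length + 1) 1) 0 = 0 :=
      sum_eq_zero fun π _ => by rw [placements_eq_zero _ _ (by simp), mul_zero]
    have h3 : ∀ x, ∑ π ∈ cuttings σ,
        X ^ maj π * placements (List.replicate (π.length + 1) 1) (x + 1) =
        ∑ π ∈ cuttings σ, X ^ maj π * placements (List.replicate (π.length + 1) 1) x +
          X ^ x * (X ^ lowDegree σ * qBinom (x + des σ) σ.length) := by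
      intro x
      rw [← ih, mul_sum, ← sum_add_distrib]
      refine sum_congr rfl fun π _ => ?_
      rw [placements_replicate_succ']
      ring
    rw [sum_cuttings_cons, sum_congr rfl (h1 x), ← mul_sum]
    simp only [des, lowDegree, List.length_cons]
    by_cases hd : HeadLT σ a
    · simp only [hd, if_true, add_zero]
      have hσ : σ ≠ [] := by
        rintro rfl
        simp [HeadLT] at hd
      have h4 : ∑ π ∈ cuttings σ,
          X ^ maj (insertHead a π) * placements (List.replicate (insertHead a π).length 1) x =
            X ^ lowDegree σ * qBinom (x + des σ) σ.length := by
        rw [← ih]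
        refine sum_congr rfl fun π hπ => ?_
        rw [mem_cuttings] at hπ
        obtain ⟨B, π, rfl, h1, h2⟩ := head_lt_of_word π hπ.1 a (hπ.2 ▸ hd)
        rw [insertHead, maj_insert_cons a B h1 h2, List.length_cons, List.length_cons]
      rw [h4]
      have hlt := des_lt_length σ hσ
      clear h4
      induction x with
      | zero =>
        rw [h2, qBinom_eq_zero _ _ (by omega), qBinom_eq_zero _ _ (by omega)]
        simp
      | succ x ihx =>
        rw [h3]
        have h5 := qBinom_succ_succ' (x + des σ + 1) σ.length
        have h6 := (qBinom_succ_right_mul (x + des σ) σ.length).2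
        rw [← add_assoc x] at ihx
        rw [show x + 1 + (des σ + 1) = x + des σ + 1 + 1 by ring,
          show x + 1 + des σ = x + des σ + 1 by ring]
        -- The Gaussian identities are available only with this power of `X`; in the non-descent
        -- case `lowDegree` supplies it.
        refine mul_left_cancel₀ (pow_ne_zero σ.length (X_ne_zero (R := ℤ))) ?_
        linear_combination X ^ σ.length * ihx - X ^ lowDegree σ * (h5 + h6)
    · simp only [hd, if_false, add_zero]
      induction x with
      | zero =>
        rw [h2, zero_add, qBinom_eq_zero _ _ ?_]
        · simp
        · cases σ with
          | nil => simp [des]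
          | cons b σ => exact (des_lt_length _ (by simp)).trans (Nat.lt_succ_self _)
      | succ x ihx =>
        rw [h3]
        have h5 := qBinom_succ_succ' (x + des σ) σ.length
        rw [show x + 1 + des σ = x + des σ + 1 by ring]
        linear_combination ihx - X ^ lowDegree σ * h5

/-! ### From tuples back to partitions -/

theorem sum_val_nonemptyBlocks {x : ℕ} (c : Fin x → Finset ℕ) :
    ((nonemptyBlocks c).map Finset.val).sum = ∑ s, (c s).val := by
  induction x with
  | zero => simp [nonemptyBlocks]
  | succ x ih =>
    rw [← Fin.cons_self_tail c, nonemptyBlocks_cons, Fin.sum_univ_succ]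
    simp only [Fin.cons_zero, Fin.cons_succ]
    rw [← ih]
    split_ifs with h
    · simp
    · simp [Finset.not_nonempty_iff_eq_empty.1 h]

theorem nonemptyBlocks_eq_nil {x : ℕ} (c : Fin x → Finset ℕ) :
    nonemptyBlocks c = [] ↔ ∀ s, ¬ (c s).Nonempty := by
  simp [nonemptyBlocks, List.filter_eq_nil_iff]

theorem zeroFree_iff_getLast? {x : ℕ} (c : Fin x → Finset ℕ) :
    ZeroFree c ↔ ∀ B ∈ (nonemptyBlocks c).getLast?, 0 ∉ B := by
  induction x with
  | zero => simp [nonemptyBlocks, ZeroFree]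
  | succ x ih =>
    rw [← Fin.cons_self_tail c]
    generalize c 0 = B
    generalize Fin.tail c = d
    have h1 : ZeroFree (Fin.cons B d : Fin (x + 1) → Finset ℕ) ↔
        ZeroFree d ∧ (0 ∈ B → ∃ t, (d t).Nonempty) := by
      simp only [ZeroFree, Fin.forall_fin_succ, Fin.exists_fin_succ, Fin.cons_zero, Fin.cons_succ,
        Fin.succ_lt_succ_iff, Fin.succ_pos, true_and, false_and, false_or,
        Fin.not_lt_zero]
      exact and_comm
    rw [h1, ih, nonemptyBlocks_cons]
    split_ifs with hB
    · rw [List.getLast?_cons]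
      cases hd : nonemptyBlocks d with
      | nil =>
        have := (nonemptyBlocks_eq_nil d).1 hd
        simp [this]
      | cons C π =>
        have h2 : ∃ t, (d t).Nonempty := by
          by_contra hcon
          push Not at hcon
          have := (nonemptyBlocks_eq_nil d).2 fun s => Finset.not_nonempty_iff_eq_empty.2 (hcon s)
          simp [this] at hd
        simp [h2, List.getLast?_cons]
    · rw [Finset.not_nonempty_iff_eq_empty] at hB
      simp [hB]

theorem lt_of_mem_content (r : ℕ) {m : ℕ} (β : Fin m → ℕ) (a : ℕ) (h : a ∈ content r β) :
    a < m + 1 := by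
  rw [content, Multiset.mem_add, Multiset.mem_sum] at h
  rcases h with h | ⟨i, -, h⟩
  · rw [Multiset.eq_of_mem_replicate h]
    omega
  · rw [Multiset.eq_of_mem_replicate h]
    omega

theorem nonemptyBlocks_mem_OP (r : ℕ) {m : ℕ} (β : Fin m → ℕ) {x : ℕ} (c : Fin x → Finset ℕ) :
    nonemptyBlocks c ∈ OP r β (nonemptyBlocks c).length ↔
      c ∈ tuples (fun a => (content r β).count a) (m + 1) x ∧ ZeroFree c := by
  have hcount : ∀ a, Multiset.count a (∑ s, (c s).val) = #{s | a ∈ c s} := by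
    intro a
    rw [Multiset.count_sum', card_filter]
    refine sum_congr rfl fun s _ => ?_
    split_ifs with h
    · exact Multiset.count_eq_one_of_mem (c s).nodup h
    · exact Multiset.count_eq_zero_of_notMem h
  rw [OP, Set.mem_ofPred_eq, ← zeroFree_iff_getLast?, mem_tuples, sum_val_nonemptyBlocks]
  constructor
  · rintro ⟨-, -, h, hz⟩
    refine ⟨⟨fun s a ha => lt_of_mem_content r β a ?_, fun a _ => ?_⟩, hz⟩
    · rw [← h, Multiset.mem_sum]
      exact ⟨s, mem_univ s, ha⟩
    · rw [← hcount, h]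
  · rintro ⟨⟨h1, h2⟩, hz⟩
    refine ⟨rfl, nonempty_of_mem_nonemptyBlocks c, ?_, hz⟩
    ext a
    rw [hcount]
    by_cases ha : a < m + 1
    · exact h2 a ha
    · rw [Multiset.count_eq_zero_of_notMem fun h => ha (lt_of_mem_content r β a h),
        card_eq_zero, filter_eq_empty_iff]
      exact fun s _ h => ha (h1 s a h)

/-- The extended ordered multiset partitions with any number of blocks. -/
noncomputable def allOP (r : ℕ) {m : ℕ} (β : Fin m → ℕ) : Finset (List (Finset ℕ)) :=
  (range ((content r β).card + 1)).biUnion fun k => (OP_finite r β k).toFinset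

theorem length_le_of_mem_OP (r : ℕ) {m : ℕ} (β : Fin m → ℕ) (k : ℕ) (π : List (Finset ℕ))
    (h : π ∈ OP r β k) : k ≤ (content r β).card := by
  obtain ⟨rfl, hne, hs, -⟩ := h
  rw [← hs]
  clear hs
  induction π with
  | nil => simp
  | cons B π ih =>
    simp only [List.mem_cons, forall_eq_or_imp] at hne
    have h1 := ih hne.2
    have h2 := card_pos.2 hne.1
    simp only [List.length_cons, List.map_cons, List.sum_cons, Multiset.card_add, card_val]
    omega

theorem mem_allOP (r : ℕ) {m : ℕ} (β : Fin m → ℕ) (π : List (Finset ℕ)) :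
    π ∈ allOP r β ↔ π ∈ OP r β π.length := by
  simp only [allOP, mem_biUnion, Set.Finite.mem_toFinset]
  constructor
  · rintro ⟨k, -, h⟩
    rwa [h.1]
  · exact fun h => ⟨_, mem_range.2 (Nat.lt_succ_of_le (length_le_of_mem_OP r β _ π h)), h⟩

theorem sum_allOP (r : ℕ) {m : ℕ} (β : Fin m → ℕ) (f : List (Finset ℕ) → ℤ[X]) :
    ∑ π ∈ allOP r β, f π =
      ∑ k ∈ range ((content r β).card + 1), ∑ π ∈ (OP_finite r β k).toFinset, f π := by
  refine sum_biUnion fun i _ j _ hij => disjoint_left.2 fun π hi hj => hij ?_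
  rw [Set.Finite.mem_toFinset] at hi hj
  exact hi.1.symm.trans hj.1

-- A tuple is a partition together with the positions of its blocks. Used with `occupied` for a
-- statistic and with `card` for the reference sum.
open Classical in
theorem sum_allOP_placements (r : ℕ) {m : ℕ} (β : Fin m → ℕ) (x : ℕ)
    (g : List (Finset ℕ) → ℤ[X]) (φ : Finset ℕ → ℕ) (hφ : φ ∅ = 0) :
    ∑ π ∈ allOP r β, g π * placements (π.map φ) x =
      ∑ c ∈ tuples (fun a => (content r β).count a) (m + 1) x with ZeroFree c,
        g (nonemptyBlocks c) * X ^ position φ c := by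
  have hmaps : ∀ c ∈ {c ∈ tuples (fun a => (content r β).count a) (m + 1) x | ZeroFree c},
      nonemptyBlocks c ∈ allOP r β := by
    intro c hc
    rw [mem_allOP, nonemptyBlocks_mem_OP]
    exact mem_filter.1 hc
  rw [← sum_fiberwise_of_maps_to hmaps]
  refine sum_congr rfl fun π hπ => ?_
  have hπ' := (mem_allOP r β π).1 hπ
  obtain ⟨-, hne, hs, -⟩ := hπ'
  rw [← sum_nonemptyBlocks_eq φ hφ (range (m + 1)).powerset (by simp) x π ?_ hne, mul_sum]
  · refine sum_congr ?_ fun c hc => ?_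
    · ext c
      rw [mem_filter, mem_filter, mem_filter, Fintype.mem_piFinset]
      constructor
      · rintro ⟨-, rfl⟩
        rw [mem_allOP, nonemptyBlocks_mem_OP] at hπ
        exact ⟨hπ, rfl⟩
      · rintro ⟨⟨h, -⟩, rfl⟩
        refine ⟨fun s => ?_, rfl⟩
        rw [mem_powerset]
        exact fun a ha => mem_range.2 ((mem_tuples.1 h).1 s a ha)
    · rw [(mem_filter.1 hc).2, position]
  · intro B hB
    rw [mem_powerset]
    intro a ha
    refine mem_range.2 (lt_of_mem_content r β a ?_)
    rw [← hs]
    exact Multiset.mem_of_le (List.single_le_sum (by simp) _ (List.mem_map_of_mem hB)) ha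

theorem map_occupied (π : List (Finset ℕ)) (h : ∀ B ∈ π, B.Nonempty) :
    π.map occupied = List.replicate π.length 1 := by
  rw [List.eq_replicate_iff]
  refine ⟨by simp, fun n hn => ?_⟩
  obtain ⟨B, hB, rfl⟩ := List.mem_map.1 hn
  simp [occupied, h B hB]

theorem sum_allOP_stat (r : ℕ) {m : ℕ} (β : Fin m → ℕ) (x : ℕ) (stat : List (Finset ℕ) → ℕ) :
    ∑ π ∈ allOP r β, X ^ stat π * placements (π.map occupied) x =
      ∑ k ∈ range ((content r β).card + 1),
        D stat r β k * placements (List.replicate k 1) x := by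
  rw [sum_allOP]
  refine sum_congr rfl fun k _ => ?_
  rw [D, sum_mul]
  refine sum_congr rfl fun π hπ => ?_
  rw [Set.Finite.mem_toFinset] at hπ
  rw [map_occupied π hπ.2.1, hπ.1]

theorem sum_insertionStat (r : ℕ) {m : ℕ} (β : Fin m → ℕ) (x : ℕ)
    (stat : List (Finset ℕ) → ℕ)
    (h : IsInsertionStat (shiftedStat stat : (Fin x → Finset ℕ) → ℕ)) :
    ∑ π ∈ allOP r β, X ^ stat π * placements (π.map occupied) x =
      ∑ π ∈ allOP r β, placements (π.map card) x := by
  classical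
  have h2 := sum_allOP_placements r β x (fun _ => 1) card rfl
  simp only [one_mul] at h2
  rw [sum_allOP_placements r β x (fun π => X ^ stat π) occupied (by simp [occupied]), h2,
    sum_filter, sum_filter]
  -- The weight is the indicator of `ZeroFree`; `reach` matters only inside the induction.
  have h3 := h.sum_eq isInsertionStat_position_card (fun a => (content r β).count a) (m + 1)
    fun _ p => if p then 1 else 0
  simpa only [ite_mul, one_mul, zero_mul, shiftedStat, pow_add] using h3

/-! ### The major index, summed over words -/

theorem coe_word (π : List (Finset ℕ)) : (word π : Multiset ℕ) = (π.map Finset.val).sum := by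
  induction π with
  | nil => simp [word]
  | cons B π ih => rw [word_cons, ← Multiset.coe_add, ih, Finset.sort_eq]; simp

theorem zero_mem_getLast?_sort (B : Finset ℕ) :
    0 ∈ (B.sort (fun a b => a ≥ b)).getLast? ↔ 0 ∈ B := by
  constructor
  · exact fun h => (Finset.mem_sort _).1 (List.mem_of_getLast? h)
  · intro h
    obtain ⟨l, l', hl⟩ := List.append_of_mem ((Finset.mem_sort (fun a b => a ≥ b)).2 h)
    have h1 := Finset.pairwise_sort B (fun a b => a ≥ b)
    have h2 := Finset.sort_nodup B (fun a b => a ≥ b)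
    rw [hl] at h1 h2 ⊢
    have h3 := (List.pairwise_cons.1 (List.pairwise_append.1 h1).2.1).1
    have h4 := (List.nodup_cons.1 (List.nodup_append.1 h2).2.1).1
    cases l' with
    | nil => simp
    | cons a l' =>
      have : a = 0 := Nat.le_zero.1 (h3 a (by simp))
      simp [this] at h4

/-- A `0` is written last in its block, so the condition on the last block depends only on the word.
-/
theorem zero_notMem_getLast?_word (π : List (Finset ℕ)) (hne : ∀ B ∈ π, B.Nonempty) :
    (∀ B ∈ π.getLast?, 0 ∉ B) ↔ 0 ∉ (word π).getLast? := by
  rcases π.eq_nil_or_concat' with rfl | ⟨π, B, rfl⟩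
  · simp [word]
  · have hB := hne B (by simp)
    have hw : word (π ++ [B]) = word π ++ B.sort (fun a b => a ≥ b) := by simp [word]
    have hs : B.sort (fun a b => a ≥ b) ≠ [] := by
      intro h
      have := Finset.length_sort (s := B) (fun a b => a ≥ b)
      rw [h] at this
      exact (card_pos.2 hB).ne this
    rw [hw, List.getLast?_append_of_ne_nil _ hs, zero_mem_getLast?_sort]
    simp

/-- The content and the condition on `0` are read off the word, so each fibre of `word` consists of
all cuttings of its word. -/
theorem sum_allOP_maj (r : ℕ) {m : ℕ} (β : Fin m → ℕ) (x : ℕ) :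
    ∑ π ∈ allOP r β, X ^ maj π * placements (π.map occupied) x =
      ∑ π ∈ allOP r β, placements (π.map card) x := by
  classical
  have hfiber : ∀ σ ∈ (allOP r β).image word, {π ∈ allOP r β | word π = σ} = cuttings σ := by
    intro σ hσ
    obtain ⟨π₀, h₀, rfl⟩ := mem_image.1 hσ
    rw [mem_allOP] at h₀
    ext π
    rw [mem_filter, mem_cuttings, mem_allOP]
    constructor
    · exact fun h => ⟨h.1.2.1, h.2⟩
    · rintro ⟨hne, hw⟩
      refine ⟨⟨rfl, hne, ?_, ?_⟩, hw⟩
      · rw [← coe_word, hw, coe_word, h₀.2.2.1]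
      · rw [zero_notMem_getLast?_word π hne, hw, ← zero_notMem_getLast?_word π₀ h₀.2.1]
        exact h₀.2.2.2
  rw [← sum_fiberwise_of_maps_to (fun π hπ => mem_image_of_mem word hπ),
    ← sum_fiberwise_of_maps_to (fun π hπ => mem_image_of_mem word hπ)
      fun π => placements (π.map card) x]
  refine sum_congr rfl fun σ hσ => ?_
  rw [hfiber σ hσ, sum_cuttings_placements_card, ← sum_cuttings_maj]
  refine sum_congr rfl fun π hπ => ?_
  rw [map_occupied π ((mem_cuttings _ _).1 hπ).1]

/-! ### Separating the numbers of blocks -/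

theorem eq_zero_of_sum_placements (n : ℕ) (f : ℕ → ℤ[X])
    (h : ∀ x, ∑ k ∈ range n, f k * placements (List.replicate k 1) x = 0) :
    ∀ k < n, f k = 0 := by
  intro k
  induction k using Nat.strong_induction_on with
  | _ k ih =>
    intro hk
    -- At `x = k` the terms with more than `k` blocks vanish, and those with fewer vanish by
    -- induction.
    have hx := h k
    rw [sum_eq_single k] at hx
    · refine (mul_eq_zero.1 hx).resolve_right ?_
      simpa using placements_length_ne_zero (List.replicate k 1)
    · intro j hj hjk
      rcases lt_or_gt_of_ne hjk with hlt | hgt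
      · rw [ih j hlt (mem_range.1 hj), zero_mul]
      · rw [placements_eq_zero _ _ (by simpa using hgt), mul_zero]
    · exact fun hn => absurd (mem_range.2 hk) hn

theorem D_eq_of_sum_eq (r : ℕ) {m : ℕ} (β : Fin m → ℕ) (k : ℕ) (s t : List (Finset ℕ) → ℕ)
    (h : ∀ x, ∑ π ∈ allOP r β, X ^ s π * placements (π.map occupied) x =
      ∑ π ∈ allOP r β, X ^ t π * placements (π.map occupied) x) :
    D s r β k = D t r β k := by
  by_cases hk : k < (content r β).card + 1
  · refine sub_eq_zero.1 (eq_zero_of_sum_placements _ (fun k => D s r β k - D t r β k)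
      (fun x => ?_) k hk)
    simp only [sub_mul, sum_sub_distrib]
    rw [← sum_allOP_stat, ← sum_allOP_stat, h, sub_self]
  · have : (OP_finite r β k).toFinset = ∅ := by
      ext π
      simp only [Set.Finite.mem_toFinset, notMem_empty, iff_false]
      exact fun hπ => hk (Nat.lt_succ_of_le (length_le_of_mem_OP r β k π hπ))
    rw [D, D, this, sum_empty, sum_empty]

end ExtOMP

theorem mainTheorem4 (r : ℕ) {m : ℕ} (β : Fin m → ℕ) (k : ℕ) :
    ExtOMP.D ExtOMP.inv r β k = ExtOMP.D ExtOMP.maj r β k ∧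
      ExtOMP.D ExtOMP.maj r β k = ExtOMP.D ExtOMP.dinv r β k := by
  constructor
  · refine ExtOMP.D_eq_of_sum_eq r β k _ _ fun x => ?_
    rw [ExtOMP.sum_allOP_maj, ExtOMP.sum_insertionStat r β x _ ExtOMP.isInsertionStat_inv]
  · refine ExtOMP.D_eq_of_sum_eq r β k _ _ fun x => ?_
    rw [ExtOMP.sum_allOP_maj, ExtOMP.sum_insertionStat r β x _ ExtOMP.isInsertionStat_dinv]
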